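/- Let $0<q<1$ and $t>0$. For $n\in\mathbb{Z}_{\ge 0}$ put $(a;q)_n=\prod_{i=0}^{n-1}(1-aq^i)$, $(a;q)_{-n}=1/\prod_{i=1}^{n}(1-aq^{-i})$, $(a;q)_\infty=\prod_{i=0}^{\infty}(1-aq^i)$ and $(a_1,\dots,a_m;q)_\infty=\prod_{j}(a_j;q)_\infty$. Let $$\mu_t=\sum_{k=-\infty}^{\infty}t^kq^{\binom{k+1}{2}}\,\delta_{tq^k},$$ where $\binom{k+1}{2}=k(k+1)/2$ and $\delta_x$ is the unit mass at $x$. Consider the Stieltjes--Wigert polynomials $$S_n(x;q)=\frac{1}{(q;q)_n}\sum_{k=0}^n\frac{(q;q)_n}{(q;q)_k(q;q)_{n-k}}(-1)^kq^{k^2}x^k,\qquad n=0,1,2,\ldots,$$ and the (second) $q$-Bessel functions $$M_r^{(t)}(x;q)=\frac{1}{(q;q)_\infty}\,\phi_{-q^r/t}(x),\quad r\in\mathbb{Z},\qquad \phi_z(x)=\sum_{n=0}^\infty\frac{(1/z;q)_n}{(q;q)_n}(-1)^nq^{\binom n2}(-xzq)^n .$$ All these functions belong to the complex Hilbert space $L^2(\mu_t)$,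 and the following hold, all the series over $k$ being absolutely convergent. For all $n,m\in\mathbb{Z}_{\ge0}$, $$\frac{1}{(-tq,-1/t,q;q)_\infty}\sum_{k=-\infty}^\infty t^kq^{\binom{k+1}{2}}S_n(tq^k;q)S_m(tq^k;q)=\frac{\delta_{m,n}}{q^n(q;q)_n};$$ for all $r,s\in\mathbb{Z}$, $$\frac{1}{(-t;q)_\infty}\sum_{k=-\infty}^\infty t^kq^{\binom{k+1}{2}}M_r^{(t)}(tq^k;q)M_s^{(t)}(tq^k;q)=\frac{(-q/t;q)_r}{q^r}\,\delta_{r,s};$$ and for all $n\in\mathbb{Z}_{\ge0}$, $r\in\mathbb{Z}$, $$\sum_{k=-\infty}^\infty t^kq^{\binom{k+1}{2}}S_n(tq^k;q)M_r^{(t)}(tq^k;q)=0.$$ Moreover, $\{S_n(x;q)\}_{n\ge0}\cup\{M_r^{(t)}(x;q)\}_{r\in\mathbb{Z}}$ is an orthogonal basis of $L^2(\mu_t)$: its members are nonzero and pairwise orthogonal, and their linear span is dense. -/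

import Mathlib

open MeasureTheory
open scoped ENNReal

/-- The finite `q`-shifted factorial `(a; q)_n = ∏_{i=0}^{n-1} (1 - a q^i)` for `n : ℕ`. -/
noncomputable def qPoch (a q : ℝ) (n : ℕ) : ℝ :=
  ∏ i ∈ Finset.range n, (1 - a * q ^ i)

/-- The `q`-shifted factorial `(a; q)_r` with an integer index: for negative index
`(a; q)_{-n} = 1 / ((1 - a q^{-1}) ⋯ (1 - a q^{-n}))`. -/
noncomputable def qPochInt (a q : ℝ) : ℤ → ℝ
  | Int.ofNat n => qPoch a q n
  | Int.negSucc n => 1 / ∏ i ∈ Finset.range (n + 1), (1 - a * q ^ (-((i : ℤ) + 1)))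

/-- The infinite `q`-shifted factorial `(a; q)_∞ = ∏_{i ≥ 0} (1 - a q^i)`, for `|q| < 1`. -/
noncomputable def qPochInf (a q : ℝ) : ℝ :=
  ∏' i : ℕ, (1 - a * q ^ i)

/-- The `q`-binomial coefficient, for `k ≤ n`. -/
noncomputable def qBinom (q : ℝ) (n k : ℕ) : ℝ :=
  qPoch q q n / (qPoch q q k * qPoch q q (n - k))

/-- The basic hypergeometric series `₁φ₁(a; b; q, z)`. -/
noncomputable def phi11 (q a b z : ℝ) : ℝ :=
  ∑' n : ℕ, qPoch a q n / (qPoch q q n * qPoch b q n) *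
    ((-1) ^ n * q ^ (n.choose 2)) * z ^ n

/-- The function `φ_z(x) = ₁φ₁(1/z; 0; q, -xzq)`, for `z ≠ 0`. -/
noncomputable def eigenPhi (q z x : ℝ) : ℝ :=
  phi11 q (1 / z) 0 (-(x * z * q))

/-- The Stieltjes–Wigert polynomial `S_n(x; q)`. -/
noncomputable def stieltjesWigert (q : ℝ) (n : ℕ) (x : ℝ) : ℝ :=
  1 / qPoch q q n *
    ∑ k ∈ Finset.range (n + 1), qBinom q n k * (-1) ^ k * q ^ (k ^ 2) * x ^ k

/-- The function `M_r^{(t)}(x; q) = φ_{-q^r/t}(x) / (q; q)_∞`, the second `q`-Bessel function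
in the variable `x`. -/
noncomputable def besselM (q t : ℝ) (r : ℤ) (x : ℝ) : ℝ :=
  1 / qPochInf q q * eigenPhi q (-(q ^ r) / t) x

/-- The weight `t^k q^{k(k+1)/2}`, for `k : ℤ`; the integer division is exact. -/
noncomputable def swWeight (q t : ℝ) (k : ℤ) : ℝ :=
  t ^ k * q ^ (k * (k + 1) / 2)

/-- The discrete measure `μ_t = ∑_{k ∈ ℤ} t^k q^{k(k+1)/2} δ_{t q^k}`. -/
noncomputable def swMeasure (q t : ℝ) : Measure ℝ :=
  Measure.sum fun k : ℤ => ENNReal.ofReal (swWeight q t k) • Measure.dirac (t * q ^ k)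

/-- An orthogonal basis of a Hilbert space: nonzero, pairwise orthogonal vectors whose linear
span is dense. -/
def IsOrthogonalBasis {ι H : Type*} [NormedAddCommGroup H] [InnerProductSpace ℂ H]
    (v : ι → H) : Prop :=
  (∀ i, v i ≠ 0) ∧ (Pairwise fun i j => inner ℂ (v i) (v j) = 0) ∧
    (Submodule.span ℂ (Set.range v)).topologicalClosure = ⊤

open Finset Filter Topology

/-! ### Elementary summability facts -/

/-! On the lattice x = t q^k, `tsum_qPoch_mul_eq` turns M_r into the series Σ_j (-1)^j t^j q^{kj+j²}
/ ((q;q)_j (q;q)_{j+r+k}), where 1/(q;q)_N = 0 for N < 0. In the coordinates (N, j) with N = j+r+k,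
the weight times the j-th term factors, because k(k+1)/2 + kj + j² = (N-r)(N-r+1)/2 + j(j-1)/2.
Summation against x^m therefore gives a product of two Euler series, one of which is (q^{-m};q)_∞ =
0, so M_r is orthogonal to all polynomials (`hasSum_pow_mul_besselM`). The same shear proves
Jacobi's triple product, hence the moments; orthogonality of the S_n is then the finite q-binomial
theorem at q^{-m}.

For a general sequence c put C(l) = Σ_N c_{l+N}/(q;q)_N. The pairing formula `hasSum_mul_besselM`
writes Σ_k c_k M_r(tq^k) as a positive infinite product times Σ_p C(-r-p) (-tq^{-r})^p/(q;q)_p. For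
c = weight · M_s one finds C(l) = weight(l)/(q;q)_{l+s}, and the p-sum becomes a q-binomial sum at
1, which gives δ_{rs}.

Completeness: suppose c annihilates every S_n and M_r. The vanishing moments force C(-L) = O(t^{-L}
q^{L²/2}) (`exists_abs_qTransform_le`). With b_L = (-1)^L t^L q^{-L(L-1)/2} C(-L), the pairing
formula says Σ_n b_{r+n} q^{n(n-1)/2}/(q;q)_n = 0 for all r. This system has nonzero solutions, such
as b_n = (-1)^n q^{-in} with i ≥ 0, but the decay b_L = O(q^{L/2}) excludes them
(`eq_zero_of_tsum_euler_eq_zero`). Thus C = 0, and C determines c. -/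

theorem summable_exp_quadratic_int {a : ℝ} (ha : a < 0) (b : ℝ) :
    Summable fun k : ℤ => Real.exp (a * (k : ℝ) ^ 2 + b * k) := by
  have hpi := Real.pi_pos
  refine Summable.of_nonneg_of_le (fun _ => (Real.exp_pos _).le) (fun k => ?_)
    -- The theta-function majorant with S = |b|/(2π) and T = -a/π has exponent a k² + |b||k|.
    (summable_pow_mul_jacobiTheta₂_term_bound (|b| / (2 * Real.pi))
      (div_pos (neg_pos.2 ha) hpi) 0)
  rw [pow_zero, one_mul]
  refine Real.exp_le_exp.2 ?_
  have h1 : b * k ≤ |b| * |(k : ℝ)| := by rw [← abs_mul]; exact le_abs_self _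
  have h2 : -Real.pi * (-a / Real.pi * (k : ℝ) ^ 2 - 2 * (|b| / (2 * Real.pi)) * |(k : ℝ)|)
      = a * (k : ℝ) ^ 2 + |b| * |(k : ℝ)| := by
    field_simp; ring
  rw [Int.cast_abs, h2]
  linarith

theorem summable_exp_quadratic_nat {a : ℝ} (ha : a < 0) (b : ℝ) :
    Summable fun k : ℕ => Real.exp (a * (k : ℝ) ^ 2 + b * k) := by
  simpa using! (summable_exp_quadratic_int ha b).comp_injective Nat.cast_injective

/-- Powers of q and t are rewritten as exponentials throughout, so that each rearrangement of a
double series reduces to a polynomial identity between exponents. -/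
theorem pow_eq_exp_mul_log {q : ℝ} (hq : 0 < q) (n : ℕ) : q ^ n = Real.exp (n * Real.log q) := by
  rw [mul_comm, Real.exp_mul, Real.exp_log hq, Real.rpow_natCast]

theorem zpow_eq_exp_mul_log {q : ℝ} (hq : 0 < q) (n : ℤ) : q ^ n = Real.exp (n * Real.log q) := by
  rw [mul_comm, Real.exp_mul, Real.exp_log hq, Real.rpow_intCast]

theorem pow_choose_two_eq_exp {q : ℝ} (hq : 0 < q) (n : ℕ) :
    q ^ n.choose 2 = Real.exp ((n * (n - 1) / 2 : ℝ) * Real.log q) := by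
  rw [pow_eq_exp_mul_log hq, Nat.cast_choose_two]

theorem choose_two_add (j m : ℕ) : (j + m).choose 2 = j.choose 2 + m.choose 2 + j * m := by
  have : (((j + m).choose 2 : ℕ) : ℚ) = ((j.choose 2 + m.choose 2 + j * m : ℕ) : ℚ) := by
    push_cast [Nat.cast_choose_two]; ring
  exact_mod_cast this

theorem choose_two_succ (j : ℕ) : (j + 1).choose 2 = j.choose 2 + j := by
  simpa using choose_two_add j 1

theorem summable_pow_mul_pow_choose_two {q : ℝ} (hq0 : 0 < q) (hq1 : q < 1) (z : ℝ) :
    Summable fun n : ℕ => |z| ^ n * q ^ n.choose 2 := by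
  have hl : Real.log q < 0 := Real.log_neg hq0 hq1
  have hz : 0 < |z| + 1 := by positivity
  refine Summable.of_nonneg_of_le (fun _ => by positivity) (fun n => ?_)
    (summable_exp_quadratic_nat (a := Real.log q / 2) (by linarith)
      (Real.log (|z| + 1) - Real.log q / 2))
  calc |z| ^ n * q ^ n.choose 2 ≤ (|z| + 1) ^ n * q ^ n.choose 2 := by gcongr; linarith
    _ = _ := by
      rw [pow_choose_two_eq_exp hq0, pow_eq_exp_mul_log hz, ← Real.exp_add]
      congr 1; ring

/-- Dominated convergence: only n = 0 survives. The uniqueness arguments use it to isolate one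
coefficient. -/
theorem tendsto_tsum_mul_pow {q : ℝ} (hq0 : 0 < q) (hq1 : q < 1) {a : ℕ → ℝ} (ha : Summable a) :
    Tendsto (fun j : ℕ => ∑' n, a n * q ^ (j * n)) atTop (𝓝 (a 0)) := by
  have key : Tendsto (fun j : ℕ => ∑' n, a n * q ^ (j * n)) atTop
      (𝓝 (∑' n, if n = 0 then a 0 else 0)) := by
    refine tendsto_tsum_of_dominated_convergence (bound := fun n => ‖a n‖) ha.norm ?_ ?_
    · intro n
      rcases Nat.eq_zero_or_pos n with rfl | hn
      · simp
      · simp only [hn.ne', if_false]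
        have : Tendsto (fun j : ℕ => a n * (q ^ n) ^ j) atTop (𝓝 (a n * 0)) :=
          (tendsto_pow_atTop_nhds_zero_of_lt_one (by positivity)
            (pow_lt_one₀ hq0.le hq1 hn.ne')).const_mul _
        rw [mul_zero] at this
        refine this.congr fun j => ?_
        rw [← pow_mul, mul_comm n j]
    · refine Eventually.of_forall fun j n => ?_
      rw [norm_mul, Real.norm_of_nonneg (by positivity : (0 : ℝ) ≤ q ^ (j * n))]
      exact mul_le_of_le_one_right (norm_nonneg _) (pow_le_one₀ hq0.le hq1.le)
  simpa using! key

theorem tsum_prod_eq_tsum_antidiagonal {T : ℕ × ℕ → ℝ} (hT : Summable T) :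
    ∑' x, T x = ∑' n, ∑ x ∈ antidiagonal n, T x := by
  rw [← Finset.HasAntidiagonal.sigmaAntidiagonalEquivProd.tsum_eq T]
  have h := Finset.HasAntidiagonal.sigmaAntidiagonalEquivProd.summable_iff.mpr hT
  refine (h.tsum_sigma' fun n => (hasSum_fintype _).summable).trans (tsum_congr fun n => ?_)
  rw [tsum_fintype]
  exact Finset.sum_coe_sort (antidiagonal n) T

/-! ### Finite and infinite `q`-shifted factorials -/

theorem qPoch_zero (a q : ℝ) : qPoch a q 0 = 1 := by simp [qPoch]

theorem qPoch_succ (a q : ℝ) (n : ℕ) : qPoch a q (n + 1) = qPoch a q n * (1 - a * q ^ n) :=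
  Finset.prod_range_succ _ _

theorem qPoch_add (a q : ℝ) (n m : ℕ) :
    qPoch a q (n + m) = qPoch a q n * qPoch (a * q ^ n) q m := by
  simp only [qPoch, Finset.prod_range_add, pow_add, mul_assoc]

theorem qPoch_succ_left (a q : ℝ) (n : ℕ) :
    qPoch a q (n + 1) = (1 - a) * qPoch (a * q) q n := by
  rw [add_comm, qPoch_add]; simp [qPoch]

theorem qPoch_self_succ (q : ℝ) (n : ℕ) :
    qPoch q q (n + 1) = qPoch q q n * (1 - q ^ (n + 1)) := by
  rw [qPoch_succ, pow_succ']

theorem one_sub_pow_succ_pos {q : ℝ} (hq0 : 0 < q) (hq1 : q < 1) (n : ℕ) :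
    0 < 1 - q ^ (n + 1) :=
  sub_pos.2 (pow_lt_one₀ hq0.le hq1 n.succ_ne_zero)

theorem qPoch_self_pos {q : ℝ} (hq0 : 0 < q) (hq1 : q < 1) (n : ℕ) : 0 < qPoch q q n := by
  induction n with
  | zero => simp [qPoch]
  | succ n ih => rw [qPoch_self_succ]; exact mul_pos ih (one_sub_pow_succ_pos hq0 hq1 n)

theorem summable_mul_geometric {q : ℝ} (hq0 : 0 < q) (hq1 : q < 1) (a : ℝ) :
    Summable fun i : ℕ => ‖-(a * q ^ i)‖ :=
  (((summable_geometric_of_lt_one hq0.le hq1).mul_left a).neg).norm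

theorem tendsto_qPoch {q : ℝ} (hq0 : 0 < q) (hq1 : q < 1) (a : ℝ) :
    Tendsto (fun n => qPoch a q n) atTop (𝓝 (qPochInf a q)) := by
  have h := (multipliable_one_add_of_summable (summable_mul_geometric hq0 hq1 a)).hasProd
  simpa only [← sub_eq_add_neg] using! h.tendsto_prod_nat

theorem qPochInf_eq_qPoch_mul {q : ℝ} (hq0 : 0 < q) (hq1 : q < 1) (a : ℝ) (n : ℕ) :
    qPochInf a q = qPoch a q n * qPochInf (a * q ^ n) q := by
  refine tendsto_nhds_unique ((tendsto_add_atTop_iff_nat n).2 (tendsto_qPoch hq0 hq1 a)) ?_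
  refine ((tendsto_qPoch hq0 hq1 (a * q ^ n)).const_mul (qPoch a q n)).congr fun m => ?_
  rw [add_comm, qPoch_add]

theorem qPochInf_eq_one_sub_mul {q : ℝ} (hq0 : 0 < q) (hq1 : q < 1) (a : ℝ) :
    qPochInf a q = (1 - a) * qPochInf (a * q) q := by
  simpa [qPoch] using qPochInf_eq_qPoch_mul hq0 hq1 a 1

theorem qPochInf_pos {q : ℝ} (hq0 : 0 < q) (hq1 : q < 1) {a : ℝ} (ha : a < 1) :
    0 < qPochInf a q := by
  have hf : ∀ i : ℕ, 0 < 1 - a * q ^ i := fun i => by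
    have h1 : q ^ i ≤ 1 := pow_le_one₀ hq0.le hq1.le
    have h2 : 0 < q ^ i := by positivity
    nlinarith
  refine lt_of_le_of_ne ?_ (Ne.symm ?_)
  · exact ge_of_tendsto' (tendsto_qPoch hq0 hq1 a) fun n => Finset.prod_nonneg fun i _ => (hf i).le
  · have := tprod_one_add_ne_zero_of_summable (f := fun i : ℕ => -(a * q ^ i))
      (fun i => by rw [← sub_eq_add_neg]; exact (hf i).ne') (summable_mul_geometric hq0 hq1 a)
    simpa only [← sub_eq_add_neg] using! this

theorem qPochInf_le_one {q : ℝ} (hq0 : 0 < q) (hq1 : q < 1) {a : ℝ} (h0 : 0 ≤ a) (h1 : a ≤ 1) :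
    qPochInf a q ≤ 1 := by
  refine le_of_tendsto' (tendsto_qPoch hq0 hq1 a) fun n => ?_
  have hb : ∀ i : ℕ, 0 ≤ a * q ^ i ∧ a * q ^ i ≤ 1 := fun i =>
    ⟨by positivity, mul_le_one₀ h1 (by positivity) (pow_le_one₀ hq0.le hq1.le)⟩
  exact Finset.prod_le_one (fun i _ => by linarith [(hb i).2]) fun i _ => by linarith [(hb i).1]

theorem qPochInf_self_pos {q : ℝ} (hq0 : 0 < q) (hq1 : q < 1) : 0 < qPochInf q q :=
  qPochInf_pos hq0 hq1 hq1

theorem one_div_qPoch_self_le {q : ℝ} (hq0 : 0 < q) (hq1 : q < 1) (n : ℕ) :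
    1 / qPoch q q n ≤ 1 / qPochInf q q := by
  refine one_div_le_one_div_of_le (qPochInf_self_pos hq0 hq1) ?_
  rw [qPochInf_eq_qPoch_mul hq0 hq1 q n]
  refine mul_le_of_le_one_right (qPoch_self_pos hq0 hq1 n).le (qPochInf_le_one hq0 hq1 (by positivity) ?_)
  rw [← pow_succ']; exact pow_le_one₀ hq0.le hq1.le

theorem summable_div_qPoch_self {q : ℝ} (hq0 : 0 < q) (hq1 : q < 1) {A : ℕ → ℝ}
    (hA : Summable A) : Summable fun n => A n / qPoch q q n := by
  refine Summable.of_norm_bounded (hA.norm.mul_right (1 / qPochInf q q)) fun n => ?_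
  rw [div_eq_mul_one_div, norm_mul, Real.norm_of_nonneg (one_div_pos.2 (qPoch_self_pos hq0 hq1 n)).le]
  exact mul_le_mul_of_nonneg_left (one_div_qPoch_self_le hq0 hq1 n) (norm_nonneg _)

theorem div_qPoch_self_succ_mul {q : ℝ} (hq0 : 0 < q) (hq1 : q < 1) (x : ℝ) (n : ℕ) :
    x / qPoch q q (n + 1) * (1 - q ^ (n + 1)) = x / qPoch q q n := by
  rw [qPoch_self_succ]
  have := (one_sub_pow_succ_pos hq0 hq1 n).ne'
  have := (qPoch_self_pos hq0 hq1 n).ne'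
  field_simp

theorem summable_mul_pow_of_le_one {q : ℝ} (hq0 : 0 < q) (hq1 : q < 1) {a : ℕ → ℝ}
    (ha : Summable a) (j : ℕ) : Summable fun n => a n * q ^ (j * n) := by
  refine Summable.of_norm_bounded ha.norm fun n => ?_
  rw [norm_mul, Real.norm_of_nonneg (by positivity : (0 : ℝ) ≤ q ^ (j * n))]
  exact mul_le_of_le_one_right (norm_nonneg _) (pow_le_one₀ hq0.le hq1.le)

/-- The `q`-difference of a series with denominators `(q; q)_n` is the shifted series. -/
theorem tsum_sub_tsum_mul_pow {q : ℝ} (hq0 : 0 < q) (hq1 : q < 1) {A : ℕ → ℝ}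
    (hA : Summable A) :
    ∑' n, A n / qPoch q q n - ∑' n, A n * q ^ n / qPoch q q n = ∑' n, A (n + 1) / qPoch q q n := by
  have h1 := summable_div_qPoch_self hq0 hq1 hA
  have h2 : Summable fun n => A n * q ^ n / qPoch q q n :=
    summable_div_qPoch_self hq0 hq1 (by simpa using summable_mul_pow_of_le_one hq0 hq1 hA 1)
  rw [← h1.tsum_sub h2, (h1.sub h2).tsum_eq_zero_add]
  simp only [pow_zero, mul_one, sub_self, zero_add]
  refine tsum_congr fun n => ?_
  rw [← div_qPoch_self_succ_mul hq0 hq1 (A (n + 1)) n, mul_sub, mul_one, div_mul_eq_mul_div]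

/-- The finite `q`-binomial theorem. -/
theorem sum_antidiagonal_qBinomial {q : ℝ} (hq0 : 0 < q) (hq1 : q < 1) (L : ℕ) (z : ℝ) :
    ∑ x ∈ antidiagonal L, (-1) ^ x.1 * q ^ x.1.choose 2 * z ^ x.1 /
      (qPoch q q x.1 * qPoch q q x.2) = qPoch z q L / qPoch q q L := by
  induction L generalizing z with
  | zero => simp [qPoch]
  | succ L ih =>
    set T : ℝ → ℕ × ℕ → ℝ := fun z x => (-1) ^ x.1 * q ^ x.1.choose 2 * z ^ x.1 /
      (qPoch q q x.1 * qPoch q q x.2) with hT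
    have hL := (one_sub_pow_succ_pos hq0 hq1 L).ne'
    -- `h1` and `h2` come from splitting 1 - q^{L+1} = q^i (1 - q^j) + (1 - q^i) for i + j = L + 1;
    -- each piece cancels one denominator factor.
    have h1 : ∑ x ∈ antidiagonal (L + 1), q ^ x.1 * (1 - q ^ x.2) * T z x
        = ∑ x ∈ antidiagonal L, T (z * q) x := by
      rw [Finset.Nat.sum_antidiagonal_succ']
      simp only [pow_zero, sub_self, mul_zero, zero_mul, zero_add]
      refine Finset.sum_congr rfl fun x _ => ?_
      simp only [hT]
      rw [qPoch_self_succ]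
      have := (one_sub_pow_succ_pos hq0 hq1 x.2).ne'
      have := (qPoch_self_pos hq0 hq1 x.1).ne'
      have := (qPoch_self_pos hq0 hq1 x.2).ne'
      field_simp
      rw [mul_pow, mul_comm]
    have h2 : ∑ x ∈ antidiagonal (L + 1), (1 - q ^ x.1) * T z x
        = -z * ∑ x ∈ antidiagonal L, T (z * q) x := by
      rw [Finset.Nat.sum_antidiagonal_succ, Finset.mul_sum]
      simp only [pow_zero, sub_self, zero_mul, zero_add]
      refine Finset.sum_congr rfl fun x _ => ?_
      simp only [hT]
      rw [qPoch_self_succ, choose_two_succ]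
      have := (one_sub_pow_succ_pos hq0 hq1 x.1).ne'
      have := (qPoch_self_pos hq0 hq1 x.1).ne'
      have := (qPoch_self_pos hq0 hq1 x.2).ne'
      field_simp
      ring
    have h3 : (1 - q ^ (L + 1)) * ∑ x ∈ antidiagonal (L + 1), T z x
        = (1 - z) * ∑ x ∈ antidiagonal L, T (z * q) x := by
      rw [sub_mul 1 z, one_mul, sub_eq_add_neg _ (z * _), ← neg_mul, ← h2, ← h1,
        ← Finset.sum_add_distrib, Finset.mul_sum]
      refine Finset.sum_congr rfl fun x hx => ?_
      rw [← Finset.HasAntidiagonal.mem_antidiagonal.1 hx, pow_add]; ring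
    rw [ih] at h3
    rw [qPoch_self_succ, qPoch_succ_left]
    have := (qPoch_self_pos hq0 hq1 L).ne'
    field_simp at h3 ⊢
    linarith

theorem summable_euler {q : ℝ} (hq0 : 0 < q) (hq1 : q < 1) (z : ℝ) :
    Summable fun i : ℕ => (-1) ^ i * q ^ i.choose 2 * z ^ i := by
  refine Summable.of_norm ((summable_pow_mul_pow_choose_two hq0 hq1 z).congr fun n => ?_)
  simp [abs_of_pos hq0, mul_comm]

/-- Euler's expansion of `(z; q)_∞`. -/
theorem tsum_euler {q : ℝ} (hq0 : 0 < q) (hq1 : q < 1) (z : ℝ) :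
    ∑' i : ℕ, (-1) ^ i * q ^ i.choose 2 * z ^ i / qPoch q q i = qPochInf z q := by
  set F : ℝ → ℝ := fun z => ∑' i : ℕ, (-1) ^ i * q ^ i.choose 2 * z ^ i / qPoch q q i with hF
  have step : ∀ z, F z = (1 - z) * F (z * q) := fun z => by
    have h := tsum_sub_tsum_mul_pow hq0 hq1 (summable_euler hq0 hq1 z)
    have h1 : ∑' n : ℕ, (-1) ^ n * q ^ n.choose 2 * z ^ n * q ^ n / qPoch q q n = F (z * q) :=
      tsum_congr fun n => by rw [mul_pow]; ring
    have h2 : ∑' n : ℕ, (-1) ^ (n + 1) * q ^ (n + 1).choose 2 * z ^ (n + 1) / qPoch q q n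
        = -z * F (z * q) := by
      rw [← tsum_mul_left]
      refine tsum_congr fun n => ?_
      rw [choose_two_succ]; ring
    rw [h1, h2] at h
    have : F z - F (z * q) = -z * F (z * q) := h
    linarith
  have iter : ∀ n : ℕ, F z = qPoch z q n * F (z * q ^ n) := fun n => by
    induction n with
    | zero => simp [qPoch]
    | succ n ih => rw [ih, step (z * q ^ n), qPoch_succ]; ring_nf
  have lim : Tendsto (fun n : ℕ => F (z * q ^ n)) atTop (𝓝 1) := by
    have h := tendsto_tsum_mul_pow hq0 hq1 (summable_div_qPoch_self hq0 hq1 (summable_euler hq0 hq1 z))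
    simp only [pow_zero, Nat.choose_zero_succ, mul_one, qPoch_zero, div_one] at h
    refine h.congr fun n => tsum_congr fun i => ?_
    rw [mul_pow, pow_mul]; ring
  have := (tendsto_qPoch hq0 hq1 z).mul lim
  simp only [← iter, mul_one] at this
  exact tendsto_nhds_unique tendsto_const_nhds this

/-- Transformation of a `₁φ₁` series with vanishing lower parameter. -/
theorem tsum_qPoch_mul_eq {q : ℝ} (hq0 : 0 < q) (hq1 : q < 1) (a z : ℝ) :
    ∑' n : ℕ, qPoch a q n / qPoch q q n * ((-1) ^ n * q ^ n.choose 2) * z ^ n =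
      ∑' j : ℕ, (a * z) ^ j * (q ^ j.choose 2) ^ 2 / qPoch q q j * qPochInf (z * q ^ j) q := by
  -- Summed over the second index, `T` gives Euler's series for (zq^j;q)_∞; summed along
  -- antidiagonals, it gives the finite q-binomial expansion of (a;q)_n.
  set T : ℕ × ℕ → ℝ := fun x => ((a * z) ^ x.1 * (q ^ x.1.choose 2) ^ 2 / qPoch q q x.1) *
    ((-1) ^ x.2 * q ^ x.2.choose 2 * (z * q ^ x.1) ^ x.2 / qPoch q q x.2) with hT
  have hsum : Summable T := by
    have h1 := (summable_div_qPoch_self hq0 hq1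
      (summable_pow_mul_pow_choose_two hq0 hq1 (a * z)))
    have h2 := (summable_div_qPoch_self hq0 hq1 (summable_pow_mul_pow_choose_two hq0 hq1 z))
    have hp := fun n => (qPoch_self_pos hq0 hq1 n).le
    refine Summable.of_norm_bounded (h1.mul_of_nonneg h2
      (fun n => div_nonneg (by positivity) (hp n)) (fun n => div_nonneg (by positivity) (hp n)))
      fun x => ?_
    simp only [hT, norm_mul, norm_div, norm_pow, Real.norm_eq_abs, abs_neg, abs_one, one_pow,
      one_mul, abs_of_pos hq0, abs_of_pos (qPoch_self_pos hq0 hq1 _)]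
    have e1 : (q ^ x.1.choose 2) ^ 2 ≤ q ^ x.1.choose 2 := by
      rw [sq]; exact mul_le_of_le_one_right (by positivity) (pow_le_one₀ hq0.le hq1.le)
    have e2 : (|z| * q ^ x.1) ^ x.2 ≤ |z| ^ x.2 := by
      refine pow_le_pow_left₀ (by positivity) ?_ _
      exact mul_le_of_le_one_right (by positivity) (pow_le_one₀ hq0.le hq1.le)
    have := hp x.1
    have := hp x.2
    rw [mul_comm (|z| ^ x.2), mul_pow |a| |z|, abs_mul, mul_pow |a| |z|]
    gcongr
  have h1 : ∑' x, T x = ∑' j : ℕ, (a * z) ^ j * (q ^ j.choose 2) ^ 2 / qPoch q q j *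
      qPochInf (z * q ^ j) q := by
    rw [hsum.tsum_prod]
    refine tsum_congr fun j => ?_
    simp only [hT]
    rw [tsum_mul_left, tsum_euler hq0 hq1]
  rw [← h1, tsum_prod_eq_tsum_antidiagonal hsum]
  refine tsum_congr fun n => ?_
  rw [← sum_antidiagonal_qBinomial hq0 hq1, mul_assoc, Finset.sum_mul]
  refine Finset.sum_congr rfl fun x hx => ?_
  rw [← Finset.HasAntidiagonal.mem_antidiagonal.1 hx, choose_two_add]
  simp only [hT, pow_add, pow_mul, mul_pow]
  have hs : (-1 : ℝ) ^ x.1 * (-1) ^ x.1 = 1 := by rw [← mul_pow]; simp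
  have := (qPoch_self_pos hq0 hq1 x.1).ne'
  have := (qPoch_self_pos hq0 hq1 x.2).ne'
  field_simp
  linear_combination (a ^ x.1 * z ^ x.1 * z ^ x.2) * hs

/-! ### The reciprocal `1 / (q; q)_N` extended by zero to negative indices -/

/-- `1 / (q; q)_N`, understood as `0` for negative `N`. -/
noncomputable def qRecip (q : ℝ) (N : ℤ) : ℝ :=
  if 0 ≤ N then 1 / qPoch q q N.toNat else 0

theorem qRecip_natCast (q : ℝ) (n : ℕ) : qRecip q n = 1 / qPoch q q n := by simp [qRecip]

theorem qRecip_of_neg (q : ℝ) {N : ℤ} (hN : N < 0) : qRecip q N = 0 := by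
  simp [qRecip, not_le.2 hN]

theorem qRecip_nonneg {q : ℝ} (hq0 : 0 < q) (hq1 : q < 1) (N : ℤ) : 0 ≤ qRecip q N := by
  unfold qRecip
  split_ifs
  exacts [(one_div_pos.2 (qPoch_self_pos hq0 hq1 _)).le, le_rfl]

theorem qRecip_le {q : ℝ} (hq0 : 0 < q) (hq1 : q < 1) (N : ℤ) :
    qRecip q N ≤ 1 / qPochInf q q := by
  unfold qRecip
  split_ifs
  exacts [one_div_qPoch_self_le hq0 hq1 _, (one_div_pos.2 (qPochInf_self_pos hq0 hq1)).le]

theorem qPoch_eq_zero {a q : ℝ} {i n : ℕ} (hi : i < n) (h : a * q ^ i = 1) : qPoch a q n = 0 :=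
  Finset.prod_eq_zero (Finset.mem_range.2 hi) (by rw [h, sub_self])

theorem qPochInf_eq_zero {q : ℝ} (hq0 : 0 < q) (hq1 : q < 1) {a : ℝ} {i : ℕ}
    (h : a * q ^ i = 1) : qPochInf a q = 0 := by
  rw [qPochInf_eq_qPoch_mul hq0 hq1 a (i + 1), qPoch_eq_zero i.lt_succ_self h, zero_mul]

/-- The convention 1/(q;q)_N = 0 for N < 0 is the natural one: (q^{N+1};q)_∞ then contains the
factor 1 - q^0. -/
theorem qRecip_eq {q : ℝ} (hq0 : 0 < q) (hq1 : q < 1) (N : ℤ) :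
    qRecip q N = qPochInf (q ^ (N + 1)) q / qPochInf q q := by
  rcases lt_or_ge N 0 with hN | hN
  · rw [qRecip_of_neg q hN, qPochInf_eq_zero hq0 hq1 (i := (-(N + 1)).toNat), zero_div]
    rw [← zpow_natCast, ← zpow_add₀ hq0.ne', Int.toNat_of_nonneg (by omega)]
    simp
  · obtain ⟨n, rfl⟩ := Int.eq_ofNat_of_zero_le hN
    rw [qRecip_natCast, qPochInf_eq_qPoch_mul hq0 hq1 q n, ← pow_succ']
    have h1 := (qPoch_self_pos hq0 hq1 n).ne'
    have h2 := qPochInf_pos hq0 hq1 (a := q ^ (n + 1)) (pow_lt_one₀ hq0.le hq1 n.succ_ne_zero)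
    have h3 : q ^ ((n : ℤ) + 1) = q ^ (n + 1) := by norm_cast
    rw [h3]
    field_simp

/-- Lets one-sided series be summed over all of ℤ, where index shifts are bijections. -/
theorem hasSum_mul_qRecip_iff {q : ℝ} {f : ℤ → ℝ} {a : ℝ} :
    HasSum (fun N : ℤ => f N * qRecip q N) a ↔ HasSum (fun n : ℕ => f n / qPoch q q n) a := by
  rw [← Function.Injective.hasSum_iff (Nat.cast_injective (R := ℤ))]
  · refine iff_of_eq (congrArg (HasSum · a) (funext fun n => ?_))
    simp [qRecip_natCast, div_eq_mul_inv]
  · intro N hN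
    rw [qRecip_of_neg, mul_zero]
    by_contra h
    exact hN ⟨N.toNat, Int.toNat_of_nonneg (not_lt.1 h)⟩

/-- Euler's expansion of `(-e^ζ; q)_∞`, as a sum over all integers. -/
theorem hasSum_euler_int {q : ℝ} (hq0 : 0 < q) (hq1 : q < 1) (ζ : ℝ) :
    HasSum (fun N : ℤ => Real.exp ((N * (N - 1) / 2 : ℝ) * Real.log q + N * ζ) * qRecip q N)
      (qPochInf (-Real.exp ζ) q) := by
  rw [hasSum_mul_qRecip_iff (f := fun N : ℤ => Real.exp ((N * (N - 1) / 2 : ℝ) * Real.log q + N * ζ)),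
    ← tsum_euler hq0 hq1]
  convert (summable_div_qPoch_self hq0 hq1 (summable_euler hq0 hq1 (-Real.exp ζ))).hasSum using 1
  funext n
  rw [pow_choose_two_eq_exp hq0, neg_pow (Real.exp ζ), ← Real.exp_nat_mul, Real.exp_add]
  have hs : (-1 : ℝ) ^ n * (-1) ^ n = 1 := by rw [← mul_pow]; simp
  congr 1
  push_cast
  linear_combination (-Real.exp ((n * (n - 1) / 2 : ℝ) * Real.log q) * Real.exp (n * ζ)) * hs

theorem tsum_qPoch_mul_zpow_eq {q : ℝ} (hq0 : 0 < q) (hq1 : q < 1) (a : ℝ) (N : ℤ) :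
    1 / qPochInf q q * ∑' n : ℕ, qPoch a q n / qPoch q q n * ((-1) ^ n * q ^ n.choose 2) *
      (q ^ (N + 1)) ^ n =
    ∑' j : ℕ, (a * q ^ (N + 1)) ^ j * (q ^ j.choose 2) ^ 2 / qPoch q q j * qRecip q (j + N) := by
  rw [tsum_qPoch_mul_eq hq0 hq1, ← tsum_mul_left]
  refine tsum_congr fun j => ?_
  rw [qRecip_eq hq0 hq1, ← zpow_natCast q j, ← zpow_add₀ hq0.ne',
    show N + 1 + (j : ℤ) = j + N + 1 by ring]
  ring

/-- The ₁φ₁ transformation at a = 1: since (1;q)_n = 0 for n > 0, the left-hand series reduces to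
its first term. -/
theorem tsum_cauchy {q : ℝ} (hq0 : 0 < q) (hq1 : q < 1) (k : ℤ) :
    ∑' j : ℕ, Real.exp ((k * j + j ^ 2) * Real.log q) / qPoch q q j * qRecip q (j + k) =
      1 / qPochInf q q := by
  have h := tsum_qPoch_mul_zpow_eq hq0 hq1 1 k
  rw [tsum_eq_single 0 fun n hn => by
    rw [qPoch_eq_zero (Nat.pos_of_ne_zero hn) (by simp)]; simp] at h
  simp only [qPoch_zero, pow_zero, Nat.choose_zero_succ, mul_one, div_one] at h
  rw [h]
  refine tsum_congr fun j => ?_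
  rw [pow_choose_two_eq_exp hq0, zpow_eq_exp_mul_log hq0, one_mul, ← Real.exp_nat_mul,
    ← Real.exp_nat_mul, ← Real.exp_add]
  congr 3
  push_cast
  ring

/-- The bijection `(k, j) ↦ (j + c + k, j)`. -/
def shearEquiv (c : ℤ) : ℤ × ℕ ≃ ℤ × ℕ where
  toFun x := (x.2 + c + x.1, x.2)
  invFun x := (x.1 - x.2 - c, x.2)
  left_inv x := by ext <;> simp; ring
  right_inv x := by ext <;> simp

/-- The common device for the triple product and for orthogonality to monomials: a double series in
(k, j) that factors in (j + c + k, j) sums to a product. -/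
theorem hasSum_mul_shear {u : ℤ → ℝ} {v : ℕ → ℝ} {a b : ℝ} (hu : HasSum u a) (hv : HasSum v b)
    (c : ℤ) : HasSum (fun x : ℤ × ℕ => u (x.2 + c + x.1) * v x.2) (a * b) :=
  (shearEquiv c).hasSum_iff.2
    (hu.mul hv (summable_mul_of_summable_norm hu.summable.norm hv.summable.norm))

/-! ### The weight -/

theorem swWeight_eq_exp {q t : ℝ} (hq0 : 0 < q) (ht : 0 < t) (k : ℤ) :
    swWeight q t k = Real.exp (k * Real.log t + (k * (k + 1) / 2 : ℝ) * Real.log q) := by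
  have h : (((k * (k + 1) / 2 : ℤ)) : ℝ) = (k * (k + 1) / 2 : ℝ) := by
    obtain ⟨m, hm⟩ := Int.even_mul_succ_self k
    have h2 : k * (k + 1) / 2 = m := by omega
    have h3 : (k * (k + 1) : ℝ) = m + m := by exact_mod_cast hm
    rw [h2, h3]; ring
  rw [swWeight, zpow_eq_exp_mul_log hq0, zpow_eq_exp_mul_log ht, ← Real.exp_add, h]

/-- The square root of the weight. -/
noncomputable def swRoot (q t : ℝ) (k : ℤ) : ℝ :=
  Real.exp (k / 2 * Real.log t + (k * (k + 1) / 4 : ℝ) * Real.log q)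

theorem swRoot_pos (q t : ℝ) (k : ℤ) : 0 < swRoot q t k := Real.exp_pos _

theorem swRoot_mul_self {q t : ℝ} (hq0 : 0 < q) (ht : 0 < t) (k : ℤ) :
    swRoot q t k * swRoot q t k = swWeight q t k := by
  rw [swWeight_eq_exp hq0 ht, swRoot, ← Real.exp_add]
  congr 1; ring

theorem swWeight_pos {q t : ℝ} (hq0 : 0 < q) (ht : 0 < t) (k : ℤ) : 0 < swWeight q t k := by
  rw [swWeight_eq_exp hq0 ht]; exact Real.exp_pos _

theorem swPoint_eq_exp {q t : ℝ} (hq0 : 0 < q) (ht : 0 < t) (k : ℤ) :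
    t * q ^ k = Real.exp (Real.log t + k * Real.log q) := by
  rw [Real.exp_add, Real.exp_log ht, zpow_eq_exp_mul_log hq0]

/-- `swRoot` is the scale for every convergence estimate: if f is in L²(μ_t), weight · f is bounded
by a constant times `swRoot`. -/
theorem summable_swRoot_mul_exp {q t : ℝ} (hq0 : 0 < q) (hq1 : q < 1) (b : ℝ) :
    Summable fun k : ℤ => swRoot q t k * Real.exp (b * k) := by
  have hl : Real.log q < 0 := Real.log_neg hq0 hq1
  refine (summable_exp_quadratic_int (a := Real.log q / 4) (by linarith)
    (Real.log t / 2 + Real.log q / 4 + b)).congr fun k => ?_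
  rw [swRoot, ← Real.exp_add]
  congr 1; ring

theorem summable_swRoot_mul_pow {q t : ℝ} (hq0 : 0 < q) (hq1 : q < 1) (m : ℕ) :
    Summable fun k : ℤ => swRoot q t k * (t * q ^ k) ^ m := by
  refine ((summable_swRoot_mul_exp (t := t) hq0 hq1 (m * Real.log q)).mul_left (t ^ m)).congr
    fun k => ?_
  rw [mul_pow, zpow_eq_exp_mul_log hq0, ← Real.exp_nat_mul]
  ring_nf

theorem HasSum.congr_right {ι : Type*} {f : ι → ℝ} {a b : ℝ} (h : HasSum f a) (hab : b = a) :
    HasSum f b := hab ▸ h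

theorem exists_abs_le_of_summable {ι : Type*} {f : ι → ℝ} (hf : Summable f) :
    ∃ A, 0 ≤ A ∧ ∀ i, |f i| ≤ A :=
  ⟨∑' i, |f i|, tsum_nonneg fun _ => abs_nonneg _, fun i =>
    hf.abs.le_tsum i fun _ _ => abs_nonneg _⟩

/-- Jacobi's triple product identity. -/
theorem hasSum_swWeight {q t : ℝ} (hq0 : 0 < q) (hq1 : q < 1) (ht : 0 < t) :
    HasSum (swWeight q t) (qPochInf (-(t * q)) q * qPochInf (-(1 / t)) q * qPochInf q q) := by
  have h1 := hasSum_euler_int hq0 hq1 (Real.log t + Real.log q)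
  have h2 := hasSum_mul_qRecip_iff (f := fun N : ℤ =>
    Real.exp ((N * (N - 1) / 2 : ℝ) * Real.log q + N * -Real.log t)).1
    (hasSum_euler_int hq0 hq1 (-Real.log t))
  rw [Real.exp_add, Real.exp_log ht, Real.exp_log hq0] at h1
  rw [Real.exp_neg, Real.exp_log ht, ← one_div] at h2
  -- The Euler series of (-tq;q)_∞ and (-1/t;q)_∞ are multiplied and regrouped by k; the inner sum
  -- over j is `tsum_cauchy`.
  have h3 : HasSum (fun x : ℤ × ℕ => swWeight q t x.1 *
      (Real.exp ((x.1 * x.2 + x.2 ^ 2) * Real.log q) / qPoch q q x.2 * qRecip q (x.2 + x.1)))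
      (qPochInf (-(t * q)) q * qPochInf (-(1 / t)) q) := by
    refine (hasSum_mul_shear h1 h2 0).congr_fun fun x => ?_
    obtain ⟨k, j⟩ := x
    simp only [add_zero]
    rw [swWeight_eq_exp hq0 ht]
    have : ∀ A B C D P R : ℝ, C * D = A * B → C * (D / P * R) = A * R * (B / P) :=
      fun A B C D P R h => by linear_combination (R / P) * h
    apply this
    rw [← Real.exp_add, ← Real.exp_add]
    congr 1
    push_cast
    ring
  have h6 := (qPochInf_self_pos hq0 hq1).ne'
  have h5 : HasSum (fun k => swWeight q t k * (1 / qPochInf q q))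
      (qPochInf (-(t * q)) q * qPochInf (-(1 / t)) q) := by
    refine h3.prod_fiberwise fun k => ?_
    have hs := h3.summable.prod_factor k
    rw [← tsum_cauchy hq0 hq1 k]
    exact ((summable_mul_left_iff (swWeight_pos hq0 ht k).ne').1 hs).hasSum.mul_left _
  refine (h5.mul_right (qPochInf q q)).congr_fun fun k => ?_
  field_simp

theorem tsum_swWeight_pos {q t : ℝ} (hq0 : 0 < q) (hq1 : q < 1) (ht : 0 < t) :
    0 < qPochInf (-(t * q)) q * qPochInf (-(1 / t)) q * qPochInf q q := by
  have h1 : 0 < 1 / t := by positivity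
  have h2 : 0 < t * q := by positivity
  have := qPochInf_self_pos hq0 hq1
  have := qPochInf_pos hq0 hq1 (a := -(t * q)) (by linarith)
  have := qPochInf_pos hq0 hq1 (a := -(1 / t)) (by linarith)
  positivity

/-- The moments of the measure. -/
theorem hasSum_moment {q t : ℝ} (hq0 : 0 < q) (hq1 : q < 1) (ht : 0 < t) (m : ℕ) :
    HasSum (fun k : ℤ => swWeight q t k * (t * q ^ k) ^ m)
      (Real.exp (-(m * (m + 1) / 2 : ℝ) * Real.log q) *
        (qPochInf (-(t * q)) q * qPochInf (-(1 / t)) q * qPochInf q q)) := by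
  -- Multiplying the weight by (tq^k)^m translates it by m, up to the factor q^{-m(m+1)/2}.
  have h := ((Equiv.addRight (m : ℤ)).hasSum_iff.2 (hasSum_swWeight hq0 hq1 ht)).mul_left
    (Real.exp (-(m * (m + 1) / 2 : ℝ) * Real.log q))
  refine h.congr_fun fun k => ?_
  simp only [Function.comp_apply, Equiv.coe_addRight]
  rw [swWeight_eq_exp hq0 ht, swWeight_eq_exp hq0 ht, swPoint_eq_exp hq0 ht, ← Real.exp_nat_mul,
    ← Real.exp_add, ← Real.exp_add]
  congr 1
  push_cast
  ring

/-! ### Stieltjes–Wigert polynomials -/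

theorem stieltjesWigert_eq {q : ℝ} (hq0 : 0 < q) (hq1 : q < 1) (n : ℕ) (x : ℝ) :
    stieltjesWigert q n x = ∑ p ∈ antidiagonal n,
      (-1) ^ p.1 * q ^ (p.1 ^ 2) / (qPoch q q p.1 * qPoch q q p.2) * x ^ p.1 := by
  rw [Finset.Nat.sum_antidiagonal_eq_sum_range_succ
    (fun i j => (-1) ^ i * q ^ (i ^ 2) / (qPoch q q i * qPoch q q j) * x ^ i),
    stieltjesWigert, Finset.mul_sum]
  refine Finset.sum_congr rfl fun i _ => ?_
  have := (qPoch_self_pos hq0 hq1 n).ne'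
  rw [qBinom]
  field_simp

/-- Each factor 1 - q^{-i}, 1 ≤ i ≤ n, equals -q^{-i}(1 - q^i). This supplies the norm of S_n. -/
theorem qPoch_exp_neg_self {q : ℝ} (hq0 : 0 < q) (n : ℕ) :
    qPoch (Real.exp (-n * Real.log q)) q n =
      (-1) ^ n * Real.exp (-(n * (n + 1) / 2 : ℝ) * Real.log q) * qPoch q q n := by
  induction n with
  | zero => simp [qPoch]
  | succ n ih =>
    have h : Real.exp (-((n + 1 : ℕ) : ℝ) * Real.log q) * q = Real.exp (-n * Real.log q) := by
      nth_rewrite 2 [← Real.exp_log hq0]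
      rw [← Real.exp_add]; congr 1; push_cast; ring
    have h2 : (1 - Real.exp (-((n + 1 : ℕ) : ℝ) * Real.log q)) =
        - Real.exp (-((n + 1 : ℕ) : ℝ) * Real.log q) * (1 - q ^ (n + 1)) := by
      rw [pow_eq_exp_mul_log hq0, neg_mul, mul_sub, neg_mul (Real.exp _) (Real.exp _),
        ← Real.exp_add, neg_add_cancel, Real.exp_zero]
      ring
    have h3 : Real.exp (-(((n + 1 : ℕ) : ℝ) * (((n + 1 : ℕ) : ℝ) + 1) / 2) * Real.log q) =
        Real.exp (-((n + 1 : ℕ) : ℝ) * Real.log q) *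
          Real.exp (-(n * (n + 1) / 2 : ℝ) * Real.log q) := by
      rw [← Real.exp_add]; congr 1; push_cast; ring
    rw [qPoch_succ_left, h, ih, h2, qPoch_self_succ, h3]
    ring

theorem exp_neg_mul_log_mul_pow {q : ℝ} (hq0 : 0 < q) (m : ℕ) :
    Real.exp (-m * Real.log q) * q ^ m = 1 := by
  rw [pow_eq_exp_mul_log hq0, ← Real.exp_add, neg_mul, neg_add_cancel, Real.exp_zero]

/-- Inserting the moments term by term produces the finite q-binomial sum at z = q^{-m}; for m < n
the product (q^{-m};q)_n has a zero factor. -/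
theorem hasSum_swWeight_mul_stieltjesWigert_mul_pow {q t : ℝ} (hq0 : 0 < q) (hq1 : q < 1)
    (ht : 0 < t) (n m : ℕ) :
    HasSum (fun k : ℤ => swWeight q t k * stieltjesWigert q n (t * q ^ k) * (t * q ^ k) ^ m)
      (Real.exp (-(m * (m + 1) / 2 : ℝ) * Real.log q) *
        (qPochInf (-(t * q)) q * qPochInf (-(1 / t)) q * qPochInf q q) *
        (qPoch (Real.exp (-m * Real.log q)) q n / qPoch q q n)) := by
  rw [← sum_antidiagonal_qBinomial hq0 hq1, Finset.mul_sum]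
  simp only [stieltjesWigert_eq hq0 hq1, Finset.mul_sum, Finset.sum_mul]
  refine hasSum_sum fun p _ => ?_
  have hM := (hasSum_moment hq0 hq1 ht (p.1 + m)).mul_left
    ((-1) ^ p.1 * q ^ (p.1 ^ 2) / (qPoch q q p.1 * qPoch q q p.2))
  refine (hM.congr_fun fun k => ?_).congr_right ?_
  · rw [pow_add]; ring
  · have : Real.exp (-(m * (m + 1) / 2 : ℝ) * Real.log q) *
        (q ^ p.1.choose 2 * Real.exp (-m * Real.log q) ^ p.1) =
        q ^ (p.1 ^ 2) * Real.exp (-(((p.1 + m : ℕ) : ℝ) * (((p.1 + m : ℕ) : ℝ) + 1) / 2) *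
          Real.log q) := by
      rw [pow_choose_two_eq_exp hq0, pow_eq_exp_mul_log hq0 (p.1 ^ 2), ← Real.exp_nat_mul,
        ← Real.exp_add, ← Real.exp_add, ← Real.exp_add]
      congr 1
      push_cast
      ring
    linear_combination ((-1) ^ p.1 / (qPoch q q p.1 * qPoch q q p.2) *
      (qPochInf (-(t * q)) q * qPochInf (-(1 / t)) q * qPochInf q q)) * this

theorem hasSum_stieltjesWigert_of_lt {q t : ℝ} (hq0 : 0 < q) (hq1 : q < 1) (ht : 0 < t) {n m : ℕ}
    (hm : m < n) :
    HasSum (fun k : ℤ => swWeight q t k * stieltjesWigert q n (t * q ^ k) * (t * q ^ k) ^ m) 0 := by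
  have h := hasSum_swWeight_mul_stieltjesWigert_mul_pow hq0 hq1 ht n m
  rwa [qPoch_eq_zero hm (exp_neg_mul_log_mul_pow hq0 m), zero_div, mul_zero] at h

/-- Orthogonality of the Stieltjes–Wigert polynomials. -/
theorem hasSum_stieltjesWigert_mul {q t : ℝ} (hq0 : 0 < q) (hq1 : q < 1) (ht : 0 < t) (n m : ℕ) :
    HasSum (fun k : ℤ => swWeight q t k * stieltjesWigert q n (t * q ^ k) *
        stieltjesWigert q m (t * q ^ k))
      ((qPochInf (-(t * q)) q * qPochInf (-(1 / t)) q * qPochInf q q) *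
        ((if m = n then 1 else 0) / (q ^ n * qPoch q q n))) := by
  wlog hmn : m ≤ n generalizing n m with H
  · have h := H m n (le_of_not_ge hmn)
    rw [if_neg (by omega)] at h ⊢
    rw [zero_div] at h ⊢
    exact h.congr_fun fun k => by ring
  rcases hmn.lt_or_eq with hlt | rfl
  · rw [if_neg hlt.ne, zero_div, mul_zero]
    have h : HasSum (fun k : ℤ => ∑ p ∈ antidiagonal m,
        (-1) ^ p.1 * q ^ (p.1 ^ 2) / (qPoch q q p.1 * qPoch q q p.2) *
        (swWeight q t k * stieltjesWigert q n (t * q ^ k) * (t * q ^ k) ^ p.1))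
        (∑ p ∈ antidiagonal m, (-1) ^ p.1 * q ^ (p.1 ^ 2) / (qPoch q q p.1 * qPoch q q p.2) * 0) :=
      hasSum_sum fun p hp => (hasSum_stieltjesWigert_of_lt hq0 hq1 ht
        (by have := Finset.HasAntidiagonal.mem_antidiagonal.1 hp; omega)).mul_left _
    simp only [mul_zero, Finset.sum_const_zero] at h
    refine h.congr_fun fun k => ?_
    rw [stieltjesWigert_eq hq0 hq1 m, Finset.mul_sum]
    exact Finset.sum_congr rfl fun p _ => by ring
  · rw [if_pos rfl]
    have h : HasSum (fun k : ℤ => ∑ p ∈ antidiagonal m,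
        (-1) ^ p.1 * q ^ (p.1 ^ 2) / (qPoch q q p.1 * qPoch q q p.2) *
        (swWeight q t k * stieltjesWigert q m (t * q ^ k) * (t * q ^ k) ^ p.1))
        (∑ p ∈ antidiagonal m, (-1) ^ p.1 * q ^ (p.1 ^ 2) / (qPoch q q p.1 * qPoch q q p.2) *
          (Real.exp (-(p.1 * (p.1 + 1) / 2 : ℝ) * Real.log q) *
        (qPochInf (-(t * q)) q * qPochInf (-(1 / t)) q * qPochInf q q) *
        (qPoch (Real.exp (-p.1 * Real.log q)) q m / qPoch q q m))) :=
      hasSum_sum fun p hp =>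
        (hasSum_swWeight_mul_stieltjesWigert_mul_pow hq0 hq1 ht m p.1).mul_left _
    -- Only the leading monomial of the second S_m contributes.
    rw [Finset.sum_eq_single (m, 0)] at h
    · convert h.congr_fun ?_ using 1
      · simp only [qPoch_exp_neg_self hq0, qPoch_zero, mul_one]
        have hs : (-1 : ℝ) ^ m * (-1) ^ m = 1 := by rw [← mul_pow]; simp
        have hP := (qPoch_self_pos hq0 hq1 m).ne'
        have he : q ^ (m ^ 2) * Real.exp (-(m * (m + 1) / 2 : ℝ) * Real.log q) *
            Real.exp (-(m * (m + 1) / 2 : ℝ) * Real.log q) * q ^ m = 1 := by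
          rw [pow_eq_exp_mul_log hq0, pow_eq_exp_mul_log hq0 m, ← Real.exp_add, ← Real.exp_add,
            ← Real.exp_add, Real.exp_eq_one_iff]
          push_cast; ring
        have hqm : q ^ m ≠ 0 := by positivity
        generalize Real.exp (-(m * (m + 1) / 2 : ℝ) * Real.log q) = e at he ⊢
        generalize (qPochInf (-(t * q)) q * qPochInf (-(1 / t)) q * qPochInf q q) = Θ
        field_simp
        linear_combination (-Θ) * he - Θ * q ^ (m ^ 2) * e * e * q ^ m * hs
      · intro k
        rw [stieltjesWigert_eq hq0 hq1 m, Finset.mul_sum]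
        exact Finset.sum_congr rfl fun p _ => by ring
    · intro p hp hne
      have h1 := Finset.HasAntidiagonal.mem_antidiagonal.1 hp
      have h2 : p.1 < m := by
        rcases p with ⟨a, b⟩
        simp only [ne_eq, Prod.mk.injEq, not_and] at hne h1 ⊢
        omega
      rw [qPoch_eq_zero h2 (exp_neg_mul_log_mul_pow hq0 p.1)]
      simp
    · intro hp
      exact absurd (Finset.HasAntidiagonal.mem_antidiagonal.2 (by simp)) hp

/-! ### The second `q`-Bessel functions -/

/-- The terms of the Bessel-type series of `M_r^{(t)}(t q^k; q)`. -/
noncomputable def besselTerm (q t : ℝ) (r k : ℤ) (j : ℕ) : ℝ :=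
  (-1) ^ j * Real.exp (j * Real.log t + (k * j + j ^ 2) * Real.log q) / qPoch q q j *
    qRecip q (j + r + k)

/-- At x = tq^k and z = -q^r/t the argument -xzq is q^{r+k+1}, an integer power of q, so the
transformed series has coefficients 1/(q;q)_{j+r+k}. -/
theorem besselM_eq_tsum {q t : ℝ} (hq0 : 0 < q) (hq1 : q < 1) (ht : 0 < t) (r k : ℤ) :
    besselM q t r (t * q ^ k) = ∑' j, besselTerm q t r k j := by
  have hz : -(t * q ^ k * (-(q ^ r) / t) * q) = q ^ (r + k + 1) := by
    rw [zpow_add₀ hq0.ne', zpow_add₀ hq0.ne', zpow_one]; field_simp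
  have h0 : ∀ n, qPoch 0 q n = 1 := fun n => by simp [qPoch]
  rw [besselM, eigenPhi, phi11, hz]
  simp only [h0, mul_one]
  rw [tsum_qPoch_mul_zpow_eq hq0 hq1]
  refine tsum_congr fun j => ?_
  have hz2 : 1 / (-(q ^ r) / t) * q ^ (r + k + 1) = -Real.exp (Real.log t + (k + 1) * Real.log q) := by
    have : q ^ r ≠ 0 := zpow_ne_zero _ hq0.ne'
    rw [Real.exp_add, Real.exp_log ht, ← Int.cast_one, ← Int.cast_add, ← zpow_eq_exp_mul_log hq0,
      add_assoc, zpow_add₀ hq0.ne' r]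
    field_simp
    norm_num
  rw [hz2, besselTerm, neg_pow, pow_choose_two_eq_exp hq0, ← Real.exp_nat_mul, ← Real.exp_nat_mul,
    mul_assoc ((-1 : ℝ) ^ j), ← Real.exp_add, add_assoc]
  congr 4
  push_cast
  ring

/-- With N = j + r + k, the quadratic part k²/4 + kj + j² becomes (N + j - r)²/4. Terms with N < 0
vanish, and for N, j ≥ 0 the mixed term Nj/2 only helps; dropping it leaves a product of two
Gaussians. -/
theorem summable_swRoot_mul_besselTerm {q t : ℝ} (hq0 : 0 < q) (hq1 : q < 1) (r : ℤ) :
    Summable fun x : ℤ × ℕ => swRoot q t x.1 * besselTerm q t r x.1 x.2 := by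
  have hl : Real.log q < 0 := Real.log_neg hq0 hq1
  rw [← (shearEquiv r).symm.summable_iff]
  set K := 1 / qPochInf q q with hK
  have hK0 : 0 < K := one_div_pos.2 (qPochInf_self_pos hq0 hq1)
  set lt := Real.log t
  set lq := Real.log q with hlq
  have h1 := summable_exp_quadratic_int (a := lq / 4) (by linarith) (lt / 2 + (1 - 2 * r) * lq / 4)
  have h2 := summable_exp_quadratic_nat (a := lq / 4) (by linarith) (lt / 2 - (1 + 2 * r) * lq / 4)
  have h3 := (h1.mul_of_nonneg h2 (fun _ => (Real.exp_pos _).le)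
    (fun _ => (Real.exp_pos _).le)).mul_left (K * K * Real.exp (-r * lt / 2 + (r ^ 2 - r) * lq / 4))
  refine Summable.of_norm_bounded h3 fun x => ?_
  obtain ⟨N, j⟩ := x
  simp only [Function.comp_apply, shearEquiv, Equiv.coe_fn_symm_mk]
  rw [besselTerm, show (j : ℤ) + r + (N - j - r) = N by ring]
  rcases lt_or_ge N 0 with hN | hN
  · rw [qRecip_of_neg q hN, mul_zero, mul_zero, norm_zero]; positivity
  · rw [norm_mul, norm_mul, norm_div, norm_mul, norm_pow, norm_neg, norm_one, one_pow, one_mul,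
      Real.norm_of_nonneg (swRoot_pos q t _).le, Real.norm_of_nonneg (Real.exp_pos _).le,
      Real.norm_of_nonneg (qPoch_self_pos hq0 hq1 j).le, Real.norm_of_nonneg (qRecip_nonneg hq0 hq1 N),
      div_eq_mul_one_div]
    have hE : swRoot q t (N - j - r) * Real.exp (j * lt + (((N - j - r : ℤ) : ℝ) * j + j ^ 2) * lq) ≤
        Real.exp (-r * lt / 2 + (r ^ 2 - r) * lq / 4) *
        (Real.exp (lq / 4 * (N : ℝ) ^ 2 + (lt / 2 + (1 - 2 * r) * lq / 4) * N) *
        Real.exp (lq / 4 * (j : ℝ) ^ 2 + (lt / 2 - (1 + 2 * r) * lq / 4) * j)) := by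
      rw [swRoot, ← Real.exp_add, ← Real.exp_add, ← Real.exp_add, Real.exp_le_exp]
      have : (0 : ℝ) ≤ N * j := mul_nonneg (by exact_mod_cast hN) (Nat.cast_nonneg j)
      have := mul_nonneg this (neg_pos.2 hl).le
      push_cast
      linarith
    calc _ = (swRoot q t (N - j - r) * Real.exp (j * lt + (((N - j - r : ℤ) : ℝ) * j + j ^ 2) * lq)) *
          ((1 / qPoch q q j) * qRecip q N) := by ring
      _ ≤ _ * (K * K) := mul_le_mul hE (mul_le_mul (one_div_qPoch_self_le hq0 hq1 j)
          (qRecip_le hq0 hq1 N) (qRecip_nonneg hq0 hq1 N) hK0.le)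
          (mul_nonneg (one_div_pos.2 (qPoch_self_pos hq0 hq1 j)).le (qRecip_nonneg hq0 hq1 N))
          (by positivity)
      _ = _ := by ring

theorem hasSum_besselTerm {q t : ℝ} (hq0 : 0 < q) (hq1 : q < 1) (ht : 0 < t) (r k : ℤ) :
    HasSum (besselTerm q t r k) (besselM q t r (t * q ^ k)) := by
  rw [besselM_eq_tsum hq0 hq1 ht]
  exact ((summable_mul_left_iff (swRoot_pos q t k).ne').1
    ((summable_swRoot_mul_besselTerm hq0 hq1 r).prod_factor k)).hasSum

theorem summable_swRoot_mul_besselM {q t : ℝ} (hq0 : 0 < q) (hq1 : q < 1) (ht : 0 < t) (r : ℤ) :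
    Summable fun k : ℤ => swRoot q t k * besselM q t r (t * q ^ k) :=
  ((summable_swRoot_mul_besselTerm hq0 hq1 r).hasSum.prod_fiberwise fun k =>
    (hasSum_besselTerm hq0 hq1 ht r k).mul_left (swRoot q t k)).summable

theorem summable_mul_besselTerm {q t : ℝ} (hq0 : 0 < q) (hq1 : q < 1) {c : ℤ → ℝ} {A : ℝ}
    (hc : ∀ k, |c k| ≤ A * swRoot q t k) (r : ℤ) :
    Summable fun x : ℤ × ℕ => c x.1 * besselTerm q t r x.1 x.2 := by
  refine Summable.of_norm_bounded ((summable_swRoot_mul_besselTerm (t := t) hq0 hq1 r).abs.mul_left A)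
    fun x => ?_
  rw [norm_mul, abs_mul, abs_of_pos (swRoot_pos q t _), ← mul_assoc]
  exact mul_le_mul_of_nonneg_right (hc _) (abs_nonneg _)

theorem abs_swWeight_mul_le {q t : ℝ} (hq0 : 0 < q) (ht : 0 < t) {f : ℤ → ℝ}
    (hf : Summable fun k => swRoot q t k * f k) :
    ∃ A, ∀ k, |swWeight q t k * f k| ≤ A * swRoot q t k := by
  obtain ⟨A, -, hA⟩ := exists_abs_le_of_summable hf
  refine ⟨A, fun k => ?_⟩
  rw [← swRoot_mul_self hq0 ht, mul_assoc, abs_mul, abs_of_pos (swRoot_pos q t k), mul_comm]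
  exact mul_le_mul_of_nonneg_right (hA k) (swRoot_pos q t k).le

/-- The functions `M_r` are orthogonal to all monomials. -/
theorem hasSum_pow_mul_besselM {q t : ℝ} (hq0 : 0 < q) (hq1 : q < 1) (ht : 0 < t) (m : ℕ) (r : ℤ) :
    HasSum (fun k : ℤ => swWeight q t k * (t * q ^ k) ^ m * besselM q t r (t * q ^ k)) 0 := by
  set lt := Real.log t with hlt
  set lq := Real.log q with hlq
  have h1 := (hasSum_euler_int hq0 hq1 (lt + (1 + m - r) * lq)).mul_left
    (Real.exp ((m - r) * lt + ((m - r) * (m - r + 1) / 2 - m * (m + 1) / 2 : ℝ) * lq))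
  -- The j-factor is Euler's series at z = q^{-m}, which is zero.
  have h2 := (summable_div_qPoch_self hq0 hq1 (summable_euler hq0 hq1 (Real.exp (-m * lq)))).hasSum
  rw [tsum_euler hq0 hq1, qPochInf_eq_zero hq0 hq1 (exp_neg_mul_log_mul_pow hq0 m)] at h2
  have h3 := hasSum_mul_shear h1 h2 r
  rw [mul_zero] at h3
  have h4 : HasSum (fun x : ℤ × ℕ => swWeight q t x.1 * (t * q ^ x.1) ^ m *
      besselTerm q t r x.1 x.2) 0 := by
    refine h3.congr_fun fun x => ?_
    obtain ⟨k, j⟩ := x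
    simp only
    rw [besselTerm, swWeight_eq_exp hq0 ht, swPoint_eq_exp hq0 ht, pow_choose_two_eq_exp hq0,
      ← Real.exp_nat_mul, ← Real.exp_nat_mul]
    have : ∀ a₁ a₂ b c d e₁ e₂ s P R : ℝ, a₁ * a₂ * b = c * d * (e₁ * e₂) →
        a₁ * a₂ * (s * b / P * R) = c * (d * R) * (s * e₁ * e₂ / P) :=
      fun a₁ a₂ b c d e₁ e₂ s P R h => by linear_combination (s * R / P) * h
    apply this
    simp only [← Real.exp_add]
    congr 1
    push_cast
    ring
  exact h4.prod_fiberwise fun k => (hasSum_besselTerm hq0 hq1 ht r k).mul_left _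

/-! ### Pairing a sequence with the `q`-Bessel functions -/

/-- The transform `∑_N c_{l+N} q^{jN} / (q; q)_N` of a bilateral sequence. -/
noncomputable def qTransform (q : ℝ) (c : ℤ → ℝ) (j : ℕ) (l : ℤ) : ℝ :=
  ∑' N : ℕ, c (l + N) * q ^ (j * N) / qPoch q q N

theorem summable_swRoot {q t : ℝ} (hq0 : 0 < q) (hq1 : q < 1) : Summable (swRoot q t) := by
  simpa using summable_swRoot_mul_exp (t := t) hq0 hq1 0

theorem summable_of_abs_le_swRoot {q t : ℝ} (hq0 : 0 < q) (hq1 : q < 1) {c : ℤ → ℝ} {A : ℝ}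
    (hc : ∀ k, |c k| ≤ A * swRoot q t k) : Summable c :=
  Summable.of_norm_bounded ((summable_swRoot hq0 hq1).mul_left A) hc

theorem summable_comp_int_add_nat {c : ℤ → ℝ} (hc : Summable c) (l : ℤ) :
    Summable fun n : ℕ => c (l + n) :=
  hc.comp_injective fun a b h => by simpa using h

theorem qTransform_succ {q : ℝ} (hq0 : 0 < q) (hq1 : q < 1) {c : ℤ → ℝ} (hc : Summable c)
    (j : ℕ) (l : ℤ) :
    qTransform q c (j + 1) l = qTransform q c j l - q ^ j * qTransform q c j (l + 1) := by
  have h := tsum_sub_tsum_mul_pow hq0 hq1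
    (summable_mul_pow_of_le_one hq0 hq1 (summable_comp_int_add_nat hc l) j)
  have h1 : ∑' n : ℕ, c (l + n) * q ^ (j * n) * q ^ n / qPoch q q n = qTransform q c (j + 1) l :=
    tsum_congr fun n => by rw [mul_assoc, ← pow_add, add_one_mul]
  have h2 : ∑' n : ℕ, c (l + (n + 1 : ℕ)) * q ^ (j * (n + 1)) / qPoch q q n =
      q ^ j * qTransform q c j (l + 1) := by
    rw [qTransform, ← tsum_mul_left]
    refine tsum_congr fun n => ?_
    rw [mul_add_one, pow_add, show l + ((n + 1 : ℕ) : ℤ) = l + 1 + n by push_cast; ring]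
    ring
  rw [h1, h2] at h
  have h3 : qTransform q c j l = ∑' n : ℕ, c (l + n) * q ^ (j * n) / qPoch q q n := rfl
  rw [h3, ← h]; ring

/-- With E the translation l ↦ l + 1, `qTransform_succ` applies 1 - q^j E. Hence the j-th transform
is (E;q)_j applied to the zeroth, and this is its q-binomial expansion. -/
theorem qTransform_div {q : ℝ} (hq0 : 0 < q) (hq1 : q < 1) {c : ℤ → ℝ} (hc : Summable c)
    (j : ℕ) (l : ℤ) :
    qTransform q c j l / qPoch q q j = ∑ x ∈ antidiagonal j,
      (-1) ^ x.1 * q ^ x.1.choose 2 * qTransform q c 0 (l + x.1) /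
        (qPoch q q x.1 * qPoch q q x.2) := by
  induction j generalizing l with
  | zero => simp [qPoch_zero]
  | succ j ih =>
    set T : ℤ → ℕ × ℕ → ℝ := fun l x => (-1) ^ x.1 * q ^ x.1.choose 2 *
      qTransform q c 0 (l + x.1) / (qPoch q q x.1 * qPoch q q x.2) with hT
    have hL := (one_sub_pow_succ_pos hq0 hq1 j).ne'
    have h1 : ∑ x ∈ antidiagonal (j + 1), (1 - q ^ x.2) * T l x
        = ∑ x ∈ antidiagonal j, T l x := by
      rw [Finset.Nat.sum_antidiagonal_succ']
      simp only [pow_zero, sub_self, zero_mul, zero_add]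
      refine Finset.sum_congr rfl fun x _ => ?_
      simp only [hT]
      rw [qPoch_self_succ]
      have := (one_sub_pow_succ_pos hq0 hq1 x.2).ne'
      have := (qPoch_self_pos hq0 hq1 x.1).ne'
      have := (qPoch_self_pos hq0 hq1 x.2).ne'
      field_simp
    have h2 : ∑ x ∈ antidiagonal (j + 1), q ^ x.2 * (1 - q ^ x.1) * T l x
        = -q ^ j * ∑ x ∈ antidiagonal j, T (l + 1) x := by
      rw [Finset.Nat.sum_antidiagonal_succ, Finset.mul_sum]
      simp only [pow_zero, sub_self, mul_zero, zero_mul, zero_add]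
      refine Finset.sum_congr rfl fun x hx => ?_
      simp only [hT]
      rw [qPoch_self_succ, choose_two_succ, ← Finset.HasAntidiagonal.mem_antidiagonal.1 hx,
        show l + ((x.1 + 1 : ℕ) : ℤ) = l + 1 + x.1 by push_cast; ring]
      have := (one_sub_pow_succ_pos hq0 hq1 x.1).ne'
      have := (qPoch_self_pos hq0 hq1 x.1).ne'
      have := (qPoch_self_pos hq0 hq1 x.2).ne'
      field_simp
      ring
    have h3 : (1 - q ^ (j + 1)) * ∑ x ∈ antidiagonal (j + 1), T l x
        = ∑ x ∈ antidiagonal j, T l x - q ^ j * ∑ x ∈ antidiagonal j, T (l + 1) x := by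
      rw [sub_eq_add_neg _ (q ^ j * _), ← neg_mul, ← h2, ← h1,
        ← Finset.sum_add_distrib, Finset.mul_sum]
      refine Finset.sum_congr rfl fun x hx => ?_
      rw [← Finset.HasAntidiagonal.mem_antidiagonal.1 hx, pow_add]; ring
    rw [← ih, ← ih] at h3
    rw [qTransform_succ hq0 hq1 hc, qPoch_self_succ]
    have := (qPoch_self_pos hq0 hq1 j).ne'
    field_simp at h3 ⊢
    linarith

/-- Summing over N = j + r + k at fixed j gives the j-th transform at -j - r. Its expansion by
`qTransform_div` is the Cauchy product of Euler's series for (-tq^{-r};q)_∞ with the p-series; `hd`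
justifies that product. -/
theorem hasSum_mul_besselM {q t : ℝ} (hq0 : 0 < q) (hq1 : q < 1) (ht : 0 < t) {c : ℤ → ℝ} {A : ℝ}
    (hc : ∀ k, |c k| ≤ A * swRoot q t k) (r : ℤ)
    (hd : Summable fun p : ℕ => qTransform q c 0 (-r - p) *
      (-Real.exp (Real.log t - r * Real.log q)) ^ p / qPoch q q p) :
    HasSum (fun k => c k * besselM q t r (t * q ^ k))
      (qPochInf (-Real.exp (Real.log t - r * Real.log q)) q *
        ∑' p : ℕ, qTransform q c 0 (-r - p) *
          (-Real.exp (Real.log t - r * Real.log q)) ^ p / qPoch q q p) := by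
  set u := Real.exp (Real.log t - r * Real.log q) with hu
  have hcs := summable_of_abs_le_swRoot hq0 hq1 hc
  have hS := summable_mul_besselTerm hq0 hq1 hc r
  have hfib := hS.hasSum.prod_fiberwise fun k => (hasSum_besselTerm hq0 hq1 ht r k).mul_left (c k)
  refine hfib.congr_right ?_
  set G : ℕ × ℤ → ℝ := fun x => (-u) ^ x.1 / qPoch q q x.1 *
    (c (-x.1 - r + x.2) * Real.exp (x.1 * x.2 * Real.log q) * qRecip q x.2) with hG
  have hGe : ∀ x : ℤ × ℕ, G (x.2, x.2 + r + x.1) = c x.1 * besselTerm q t r x.1 x.2 := fun x => by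
    obtain ⟨k, j⟩ := x
    simp only [hG]
    rw [besselTerm, neg_pow, hu, ← Real.exp_nat_mul, show -(j : ℤ) - r + (j + r + k) = k by ring]
    have : ∀ a b d s P R C : ℝ, a * b = d → s * a / P * (C * b * R) = C * (s * d / P * R) :=
      fun a b d s P R C h => by rw [← h]; ring
    apply this
    rw [← Real.exp_add]
    congr 1
    push_cast
    ring
  let e : ℤ × ℕ ≃ ℕ × ℤ := (shearEquiv r).trans (Equiv.prodComm _ _)
  have hGs : HasSum G (∑' x : ℤ × ℕ, c x.1 * besselTerm q t r x.1 x.2) := by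
    rw [← e.hasSum_iff]
    exact hS.hasSum.congr_fun fun x => hGe x
  have hG2 := hGs.prod_fiberwise (g := fun j => (-u) ^ j / qPoch q q j * qTransform q c j (-j - r))
    fun j => by
      refine HasSum.mul_left _ ?_
      rw [hasSum_mul_qRecip_iff (f := fun N : ℤ => c (-j - r + N) * Real.exp (j * N * Real.log q))]
      have := (summable_div_qPoch_self hq0 hq1 (summable_mul_pow_of_le_one hq0 hq1
        (summable_comp_int_add_nat hcs (-j - r)) j)).hasSum
      refine this.congr_fun fun n => ?_
      rw [pow_eq_exp_mul_log hq0]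
      push_cast
      rfl
  rw [← hG2.tsum_eq, ← tsum_euler hq0 hq1,
    tsum_mul_tsum_eq_tsum_sum_antidiagonal_of_summable_norm
      (summable_div_qPoch_self hq0 hq1 (summable_euler hq0 hq1 _)).norm hd.norm]
  refine tsum_congr fun j => ?_
  rw [div_mul_comm, qTransform_div hq0 hq1 hcs, Finset.sum_mul]
  refine Finset.sum_congr rfl fun x hx => ?_
  rw [← Finset.HasAntidiagonal.mem_antidiagonal.1 hx, pow_add,
    show -((x.1 + x.2 : ℕ) : ℤ) - r + x.1 = -r - x.2 by push_cast; ring]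
  ring

theorem qPoch_one {q : ℝ} {n : ℕ} (hn : 0 < n) : qPoch 1 q n = 0 :=
  qPoch_eq_zero hn (by simp)

/-- Collecting the double series by n = N + j leaves the factor (1;q)_n, so only n = 0 remains. -/
theorem qTransform_besselM {q t : ℝ} (hq0 : 0 < q) (hq1 : q < 1) (ht : 0 < t) (s l : ℤ) :
    qTransform q (fun k => swWeight q t k * besselM q t s (t * q ^ k)) 0 l =
      swWeight q t l * qRecip q (l + s) := by
  obtain ⟨A, hA⟩ := abs_swWeight_mul_le hq0 ht (f := fun _ => 1)
    (by simpa using summable_swRoot hq0 hq1)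
  simp only [mul_one] at hA
  have hS := summable_mul_besselTerm hq0 hq1 hA s
  set T : ℕ × ℕ → ℝ := fun x => swWeight q t (l + x.1) * besselTerm q t s (l + x.1) x.2 /
    qPoch q q x.1 with hT
  have hTs : Summable T := by
    have h1 : Summable fun x : ℕ × ℕ => swWeight q t (l + x.1) * besselTerm q t s (l + x.1) x.2 :=
      hS.comp_injective (i := fun x : ℕ × ℕ => ((l + x.1, x.2) : ℤ × ℕ)) fun x y h => by
        simp only [Prod.mk.injEq, add_right_inj, Nat.cast_inj] at h
        exact Prod.ext h.1 h.2
    refine Summable.of_norm_bounded (h1.norm.mul_right (1 / qPochInf q q)) fun x => ?_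
    simp only [hT]
    rw [div_eq_mul_one_div, norm_mul _ (1 / _),
      Real.norm_of_nonneg (one_div_pos.2 (qPoch_self_pos hq0 hq1 _)).le]
    exact mul_le_mul_of_nonneg_left (one_div_qPoch_self_le hq0 hq1 _) (norm_nonneg _)
  have h1 := hTs.hasSum.prod_fiberwise (g := fun N : ℕ => swWeight q t (l + N) *
      besselM q t s (t * q ^ (l + N : ℤ)) * q ^ (0 * N) / qPoch q q N) fun N => by
    simp only [zero_mul, pow_zero, mul_one]
    exact ((hasSum_besselTerm hq0 hq1 ht s (l + N)).mul_left _).div_const _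
  rw [qTransform, h1.tsum_eq, tsum_prod_eq_tsum_antidiagonal hTs]
  have h2 : ∀ n : ℕ, ∑ x ∈ antidiagonal n, T x =
      swWeight q t (l + n) * qRecip q (l + n + s) * (qPoch 1 q n / qPoch q q n) := by
    intro n
    rw [← sum_antidiagonal_qBinomial hq0 hq1, Finset.mul_sum, ← Finset.Nat.sum_antidiagonal_swap]
    refine Finset.sum_congr rfl fun x hx => ?_
    rw [← Finset.HasAntidiagonal.mem_antidiagonal.1 hx]
    simp only [hT, Prod.fst_swap, Prod.snd_swap]
    rw [besselTerm, swWeight_eq_exp hq0 ht, swWeight_eq_exp hq0 ht, pow_choose_two_eq_exp hq0,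
      one_pow, mul_one,
      show (x.1 : ℤ) + s + (l + x.2) = l + (x.1 + x.2 : ℕ) + s by push_cast; ring]
    have : ∀ a b c d σ P P' R : ℝ, a * b = c * d →
        a * (σ * b / P * R) / P' = c * R * (σ * d / (P * P')) := fun a b c d σ P P' R h => by
      rw [div_eq_mul_inv _ (P * P'), mul_inv]
      linear_combination (σ * P⁻¹ * R * P'⁻¹) * h
    apply this
    rw [← Real.exp_add, ← Real.exp_add]
    congr 1
    push_cast
    ring
  rw [tsum_congr h2, tsum_eq_single 0 fun n hn => by
    rw [qPoch_one (Nat.pos_of_ne_zero hn), zero_div, mul_zero]]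
  simp [qPoch_zero]

theorem hasSum_besselM_mul_besselM {q t : ℝ} (hq0 : 0 < q) (hq1 : q < 1) (ht : 0 < t) (r s : ℤ) :
    HasSum (fun k => swWeight q t k * besselM q t s (t * q ^ k) * besselM q t r (t * q ^ k))
      (qPochInf (-Real.exp (Real.log t - r * Real.log q)) q *
        Real.exp (-r * Real.log t + (r * (r - 1) / 2 : ℝ) * Real.log q) *
        (if r = s then 1 else 0)) := by
  obtain ⟨A, hA⟩ := abs_swWeight_mul_le hq0 ht (summable_swRoot_mul_besselM hq0 hq1 ht s)
  have hterm : ∀ p : ℕ, qTransform q (fun k => swWeight q t k * besselM q t s (t * q ^ k)) 0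
      (-r - p) * (-Real.exp (Real.log t - r * Real.log q)) ^ p / qPoch q q p =
      Real.exp (-r * Real.log t + (r * (r - 1) / 2 : ℝ) * Real.log q) *
      ((-1) ^ p * q ^ p.choose 2 * 1 ^ p / qPoch q q p * qRecip q (s - r - p)) := fun p => by
    rw [qTransform_besselM hq0 hq1 ht, swWeight_eq_exp hq0 ht, neg_pow, ← Real.exp_nat_mul,
      pow_choose_two_eq_exp hq0, one_pow, mul_one, show -r - (p : ℤ) + s = s - r - p by ring]
    have : ∀ a b c d σ P R : ℝ, a * b = c * d →
        a * R * (σ * b) / P = c * (σ * d / P * R) := fun a b c d σ P R h => by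
      linear_combination (σ / P * R) * h
    apply this
    rw [← Real.exp_add, ← Real.exp_add]
    congr 1
    push_cast
    ring
  have hzero : ∀ p : ℕ, s - r < p → (-1) ^ p * q ^ p.choose 2 * 1 ^ p / qPoch q q p *
      qRecip q (s - r - p) = 0 := fun p hp => by
    rw [qRecip_of_neg q (by omega), mul_zero]
  -- For s ≥ r this is the q-binomial sum of order s - r at z = 1, that is (1;q)_{s-r}/(q;q)_{s-r};
  -- for s < r every term is zero.
  have hsum : HasSum (fun p : ℕ => (-1) ^ p * q ^ p.choose 2 * 1 ^ p / qPoch q q p *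
      qRecip q (s - r - p)) (if r = s then 1 else 0) := by
    rcases lt_or_ge s r with h | h
    · rw [if_neg h.ne']
      exact hasSum_zero.congr_fun fun p => hzero p (by omega)
    · obtain ⟨n, hn⟩ := Int.eq_ofNat_of_zero_le (sub_nonneg.2 h)
      have h1 := hasSum_sum_of_ne_finset_zero (L := .unconditional ℕ) (f := fun p : ℕ => (-1) ^ p * q ^ p.choose 2 * 1 ^ p /
        qPoch q q p * qRecip q (s - r - p)) (s := range (n + 1)) fun p hp => hzero p (by
          rw [Finset.mem_range] at hp; omega)
      refine h1.congr_right ?_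
      have h2 := sum_antidiagonal_qBinomial hq0 hq1 n 1
      rw [Finset.Nat.sum_antidiagonal_eq_sum_range_succ
        (fun i j => (-1) ^ i * q ^ i.choose 2 * 1 ^ i / (qPoch q q i * qPoch q q j))] at h2
      have h3 : ∑ p ∈ range (n + 1), (-1) ^ p * q ^ p.choose 2 * 1 ^ p /
          qPoch q q p * qRecip q (s - r - p) = qPoch 1 q n / qPoch q q n := by
        rw [← h2]
        refine Finset.sum_congr rfl fun p hp => ?_
        rw [Finset.mem_range] at hp
        rw [hn, show (n : ℤ) - p = ((n - p : ℕ) : ℤ) by omega, qRecip_natCast, div_mul_div_comm,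
          mul_one]
      rw [h3]
      split_ifs with hrs
      · have : n = 0 := by omega
        subst this
        simp [qPoch_zero]
      · rw [qPoch_one (by omega), zero_div]
  have hsum' := hsum.mul_left (Real.exp (-r * Real.log t + (r * (r - 1) / 2 : ℝ) * Real.log q))
  have h := hasSum_mul_besselM hq0 hq1 ht hA r (hsum'.congr_fun hterm).summable
  rw [tsum_congr hterm, hsum'.tsum_eq] at h
  exact h.congr_right (by ring)

/-! ### The squared norm of M_r through (-q/t; q)_r. -/

theorem qPochInt_add_one {a q : ℝ} (hq0 : 0 < q) (ha : a ≤ 0) (r : ℤ) :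
    qPochInt a q (r + 1) = qPochInt a q r * (1 - a * q ^ r) := by
  rcases r with n | n
  · simp only [Int.ofNat_eq_natCast, zpow_natCast]
    exact qPoch_succ a q n
  · have hpos : ∀ i : ℕ, 0 < 1 - a * q ^ (-((i : ℤ) + 1)) := fun i => by
      have : 0 < q ^ (-((i : ℤ) + 1)) := zpow_pos hq0 _
      nlinarith
    rcases n with _ | n
    · have h := (hpos 0).ne'
      simp only [Int.negSucc_eq, Nat.cast_zero, zero_add] at h ⊢
      have h1 : qPochInt a q (-1) = 1 / ∏ i ∈ range 1, (1 - a * q ^ (-((i : ℤ) + 1))) := rfl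
      have h2 : qPochInt a q 0 = qPoch a q 0 := rfl
      rw [show (-1 : ℤ) + 1 = 0 by norm_num, h1, h2, qPoch_zero, Finset.prod_range_one]
      simp only [Nat.cast_zero, zero_add]
      exact (one_div_mul_cancel h).symm
    · have h0 : Int.negSucc (n + 1) + 1 = Int.negSucc n := rfl
      have h1 : qPochInt a q (Int.negSucc n) =
        1 / ∏ i ∈ range (n + 1), (1 - a * q ^ (-((i : ℤ) + 1))) := rfl
      have h2 : qPochInt a q (Int.negSucc (n + 1)) =
        1 / ∏ i ∈ range (n + 1 + 1), (1 - a * q ^ (-((i : ℤ) + 1))) := rfl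
      rw [h0, h1, h2, Finset.prod_range_succ _ (n + 1), Int.negSucc_eq]
      have h3 := (hpos (n + 1)).ne'
      have h4 := (Finset.prod_pos (s := range (n + 1)) fun i _ => hpos i).ne'
      field_simp

/-- Both sides agree at r = 0 and are multiplied by q^r/t + 1/q when r increases by one; this factor
is positive, so the recursion also runs downwards. -/
theorem qPochInf_mul_exp_eq {q t : ℝ} (hq0 : 0 < q) (hq1 : q < 1) (ht : 0 < t) (r : ℤ) :
    qPochInf (-Real.exp (Real.log t - r * Real.log q)) q *
        Real.exp (-r * Real.log t + (r * (r - 1) / 2 : ℝ) * Real.log q) =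
      qPochInf (-t) q * (qPochInt (-(q / t)) q r / q ^ r) := by
  set H : ℤ → ℝ := fun r => qPochInf (-Real.exp (Real.log t - r * Real.log q)) q *
        Real.exp (-r * Real.log t + (r * (r - 1) / 2 : ℝ) * Real.log q) with hH
  set R : ℤ → ℝ := fun r => qPochInf (-t) q * (qPochInt (-(q / t)) q r / q ^ r) with hR
  have hpos : ∀ r : ℤ, 0 < q ^ r / t + q⁻¹ := fun r => by positivity
  have hHs : ∀ r, H (r + 1) = H r * (q ^ r / t + q⁻¹) := fun r => by
    simp only [hH]
    rw [qPochInf_eq_one_sub_mul hq0 hq1]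
    have e1 : -Real.exp (Real.log t - ((r + 1 : ℤ) : ℝ) * Real.log q) * q =
        -Real.exp (Real.log t - r * Real.log q) := by
      nth_rewrite 2 [← Real.exp_log hq0]
      rw [neg_mul, ← Real.exp_add]
      congr 2; push_cast; ring
    have e2 : (1 - -Real.exp (Real.log t - ((r + 1 : ℤ) : ℝ) * Real.log q)) *
        Real.exp (-((r + 1 : ℤ) : ℝ) * Real.log t +
          (((r + 1 : ℤ) : ℝ) * (((r + 1 : ℤ) : ℝ) - 1) / 2 : ℝ) * Real.log q) =
        Real.exp (-r * Real.log t + (r * (r - 1) / 2 : ℝ) * Real.log q) * (q ^ r / t + q⁻¹) := by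
      have e3 : q ^ r / t = Real.exp (r * Real.log q - Real.log t) := by
        rw [Real.exp_sub, Real.exp_log ht, zpow_eq_exp_mul_log hq0]
      have e4 : q⁻¹ = Real.exp (-Real.log q) := by rw [Real.exp_neg, Real.exp_log hq0]
      rw [e3, e4, sub_neg_eq_add, add_mul, one_mul, mul_add, ← Real.exp_add, ← Real.exp_add,
        ← Real.exp_add]
      congr 2
      · push_cast; ring
      · push_cast; ring
    rw [e1, mul_right_comm, e2]
    ring
  have hRs : ∀ r, R (r + 1) = R r * (q ^ r / t + q⁻¹) := fun r => by
    simp only [hR]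
    have : 0 < q / t := by positivity
    have h2 : q ^ r ≠ 0 := zpow_ne_zero _ hq0.ne'
    rw [qPochInt_add_one hq0 (by linarith), zpow_add_one₀ hq0.ne']
    field_simp
    ring
  have h0 : H 0 = R 0 := by
    have : qPochInt (-(q / t)) q 0 = 1 := qPoch_zero _ _
    simp [hH, hR, this, Real.exp_log ht]
  change H r = R r
  induction r using Int.induction_on with
  | zero => exact h0
  | succ n ih => rw [hHs, hRs, ih]
  | pred n ih =>
    have h1 := hHs (-n - 1)
    have h2 := hRs (-n - 1)
    rw [sub_add_cancel] at h1 h2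
    rw [h1, h2] at ih
    exact mul_right_cancel₀ (hpos _).ne' ih

/-- Orthogonality of the `q`-Bessel functions. -/
theorem hasSum_besselM_mul {q t : ℝ} (hq0 : 0 < q) (hq1 : q < 1) (ht : 0 < t) (r s : ℤ) :
    HasSum (fun k => swWeight q t k * besselM q t r (t * q ^ k) * besselM q t s (t * q ^ k))
      (qPochInf (-t) q * (qPochInt (-(q / t)) q r / q ^ r * (if r = s then 1 else 0))) := by
  have h := hasSum_besselM_mul_besselM hq0 hq1 ht r s
  rw [qPochInf_mul_exp_eq hq0 hq1 ht, mul_assoc] at h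
  exact h.congr_fun fun k => by ring

/-! ### Completeness -/

/-- A bilateral sequence, summable at `+∞`, that is annihilated by all the translates of the
coefficients of Euler's series is zero. -/
theorem eq_zero_of_tsum_euler_eq_zero {q : ℝ} (hq0 : 0 < q) (hq1 : q < 1) {b : ℤ → ℝ}
    (hb : ∀ r : ℤ, Summable fun n : ℕ => b (r + n))
    (h : ∀ r : ℤ, ∑' n : ℕ, b (r + n) * q ^ n.choose 2 / qPoch q q n = 0) (r : ℤ) : b r = 0 := by
  have hb' : ∀ r : ℤ, Summable fun n : ℕ => b (r + n) * q ^ n.choose 2 := fun r => by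
    refine Summable.of_norm_bounded (hb r).norm fun n => ?_
    rw [norm_mul, Real.norm_of_nonneg (by positivity : (0 : ℝ) ≤ q ^ n.choose 2)]
    exact mul_le_of_le_one_right (norm_nonneg _) (pow_le_one₀ hq0.le hq1.le)
  -- The hypothesis is g 0 = 0. It propagates to every j, and g j r tends to b r as j → ∞.
  set g : ℕ → ℤ → ℝ := fun j r => ∑' n : ℕ, b (r + n) * q ^ n.choose 2 * q ^ (j * n) / qPoch q q n
    with hg
  have hrec : ∀ j r, g j r - g (j + 1) r = q ^ j * g (j + 1) (r + 1) := fun j r => by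
    have h := tsum_sub_tsum_mul_pow hq0 hq1 (summable_mul_pow_of_le_one hq0 hq1 (hb' r) j)
    have h1 : ∑' n : ℕ, b (r + n) * q ^ n.choose 2 * q ^ (j * n) * q ^ n / qPoch q q n =
        g (j + 1) r := tsum_congr fun n => by rw [mul_assoc _ (q ^ (j * n)), ← pow_add, add_one_mul]
    have h2 : ∑' n : ℕ, b (r + (n + 1 : ℕ)) * q ^ (n + 1).choose 2 * q ^ (j * (n + 1)) /
        qPoch q q n = q ^ j * g (j + 1) (r + 1) := by
      rw [hg, ← tsum_mul_left]
      refine tsum_congr fun n => ?_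
      rw [mul_add_one, pow_add, show r + ((n + 1 : ℕ) : ℤ) = r + 1 + n by push_cast; ring,
        choose_two_succ, pow_add, add_one_mul, pow_add]
      ring
    rw [h1, h2] at h
    exact h
  have bound : ∀ j r, |g j r| ≤ (∑' n : ℕ, |b (r + n)|) * (1 / qPochInf q q) := fun j r => by
    rw [← Real.norm_eq_abs]
    refine tsum_of_norm_bounded ((hb r).abs.hasSum.mul_right _) fun n => ?_
    have h1 := qPoch_self_pos hq0 hq1 n
    rw [div_eq_mul_one_div, norm_mul, norm_mul, norm_mul, Real.norm_of_nonneg (one_div_pos.2 h1).le,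
      Real.norm_of_nonneg (by positivity : (0 : ℝ) ≤ q ^ n.choose 2),
      Real.norm_of_nonneg (by positivity : (0 : ℝ) ≤ q ^ (j * n))]
    refine mul_le_mul ?_ (one_div_qPoch_self_le hq0 hq1 n) (one_div_pos.2 h1).le (abs_nonneg _)
    rw [mul_assoc]
    exact mul_le_of_le_one_right (abs_nonneg _) (mul_le_one₀ (pow_le_one₀ hq0.le hq1.le)
      (by positivity) (pow_le_one₀ hq0.le hq1.le))
  have lim : ∀ j r, Tendsto (fun n : ℕ => |g j (r + n)|) atTop (𝓝 0) := fun j r => by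
    refine squeeze_zero (fun _ => abs_nonneg _) (fun n => bound j (r + n)) ?_
    have h1 := (tendsto_sum_nat_add fun n : ℕ => |b (r + n)|).mul_const (1 / qPochInf q q)
    rw [zero_mul] at h1
    refine h1.congr fun n => ?_
    congr 1
    refine tsum_congr fun m => ?_
    rw [Nat.cast_add, add_comm (m : ℤ), add_assoc]
  have zero : ∀ j r, g j r = 0 := fun j => by
    induction j with
    | zero => intro r; simpa [hg] using h r
    | succ j ih =>
      intro r
      -- Once g j = 0, |g (j+1)| is nondecreasing in r, yet it tends to 0 at +∞ because b is
      -- summable there.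
      have step : ∀ r, |g (j + 1) r| ≤ |g (j + 1) (r + 1)| := fun r => by
        have h1 := hrec j r
        rw [ih, zero_sub] at h1
        rw [← abs_neg, h1, abs_mul, abs_of_pos (by positivity : (0 : ℝ) < q ^ j)]
        exact mul_le_of_le_one_left (abs_nonneg _) (pow_le_one₀ hq0.le hq1.le)
      have iter : ∀ n : ℕ, |g (j + 1) r| ≤ |g (j + 1) (r + n)| := fun n => by
        induction n with
        | zero => simp
        | succ n ihn => exact ihn.trans ((step _).trans_eq (by push_cast; rw [add_assoc]))
      exact abs_nonpos_iff.1 (ge_of_tendsto' (lim (j + 1) r) iter)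
  have h2 := tendsto_tsum_mul_pow hq0 hq1 (summable_div_qPoch_self hq0 hq1 (hb' r))
  simp only [Nat.cast_zero, add_zero, Nat.choose_zero_succ, pow_zero, mul_one, qPoch_zero,
    div_one] at h2
  refine tendsto_nhds_unique h2 (tendsto_const_nhds.congr fun j => ?_)
  rw [← zero j r]
  exact tsum_congr fun n => by ring

theorem eq_zero_of_qTransform_eq_zero {q : ℝ} (hq0 : 0 < q) (hq1 : q < 1) {c : ℤ → ℝ}
    (hc : Summable c) (h : ∀ l, qTransform q c 0 l = 0) (l : ℤ) : c l = 0 := by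
  have zero : ∀ j l, qTransform q c j l = 0 := fun j => by
    induction j with
    | zero => exact h
    | succ j ih => intro l; rw [qTransform_succ hq0 hq1 hc, ih, ih]; simp
  have h2 := tendsto_tsum_mul_pow hq0 hq1
    (summable_div_qPoch_self hq0 hq1 (summable_comp_int_add_nat hc l))
  simp only [Nat.cast_zero, add_zero, qPoch_zero, div_one] at h2
  refine tendsto_nhds_unique h2 (tendsto_const_nhds.congr fun j => ?_)
  rw [← zero j l]
  exact tsum_congr fun n => by ring

/-- The coefficients of Euler's expansion of `1 / (q; q)_n` in powers of `q^n`. -/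
noncomputable def eulerCoeff (q : ℝ) (i : ℕ) : ℝ :=
  (-1) ^ i * Real.exp ((i * (i + 1) / 2 : ℝ) * Real.log q) / qPoch q q i / qPochInf q q

theorem hasSum_eulerCoeff {q : ℝ} (hq0 : 0 < q) (hq1 : q < 1) (n : ℤ) :
    HasSum (fun i : ℕ => eulerCoeff q i * Real.exp (i * n * Real.log q)) (qRecip q n) := by
  have h := (summable_div_qPoch_self hq0 hq1 (summable_euler hq0 hq1 (q ^ (n + 1)))).hasSum
  rw [tsum_euler hq0 hq1] at h
  have h2 := h.div_const (qPochInf q q)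
  rw [← qRecip_eq hq0 hq1] at h2
  refine h2.congr_fun fun i => ?_
  rw [eulerCoeff, pow_choose_two_eq_exp hq0, zpow_eq_exp_mul_log hq0, ← Real.exp_nat_mul]
  have : ∀ a b c d σ P Q : ℝ, a * b = c * d → σ * a / P / Q * b = σ * c * d / P / Q :=
    fun a b c d σ P Q h => by linear_combination (σ / P / Q) * h
  apply this
  rw [← Real.exp_add, ← Real.exp_add]
  congr 1
  push_cast
  ring

theorem abs_eulerCoeff_le {q : ℝ} (hq0 : 0 < q) (hq1 : q < 1) (i : ℕ) :
    |eulerCoeff q i| ≤ (1 / qPochInf q q) ^ 2 * Real.exp ((i * (i + 1) / 2 : ℝ) * Real.log q) := by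
  have h1 := qPoch_self_pos hq0 hq1 i
  have h2 := qPochInf_self_pos hq0 hq1
  rw [eulerCoeff, abs_div, abs_div, abs_mul, abs_pow, abs_neg, abs_one, one_pow, one_mul,
    abs_of_pos h1, abs_of_pos h2, abs_of_pos (Real.exp_pos _), div_eq_mul_one_div,
    div_eq_mul_one_div (Real.exp _), sq]
  have := one_div_qPoch_self_le hq0 hq1 i
  have h3 : 0 < 1 / qPochInf q q := one_div_pos.2 h2
  have := mul_le_mul_of_nonneg_left this (mul_pos (Real.exp_pos ((i * (i + 1) / 2 : ℝ) * Real.log q)) h3).le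
  linarith

/-- Uniform bound for the remainder of the truncated Euler expansion of `1 / (q; q)_n`. -/
theorem exists_abs_qRecip_sub_le {q : ℝ} (hq0 : 0 < q) (hq1 : q < 1) :
    ∃ K, 0 ≤ K ∧ ∀ (m : ℕ) (n : ℤ), |qRecip q n - ∑ i ∈ range (m + 1),
      eulerCoeff q i * Real.exp (i * n * Real.log q)| ≤
      K * Real.exp (((m + 1 / 2) * n + (m + 1) ^ 2 / 2 : ℝ) * Real.log q) := by
  have hl : Real.log q < 0 := Real.log_neg hq0 hq1
  set B := (1 / qPochInf q q) ^ 2 with hB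
  have hB0 : 0 ≤ B := sq_nonneg _
  have hsum : Summable fun s : ℕ => Real.exp ((s * (s + 1) / 2 : ℝ) * Real.log q) :=
    (summable_exp_quadratic_nat (a := Real.log q / 2) (by linarith) (Real.log q / 2)).congr
      fun s => by congr 1; ring
  refine ⟨B * ∑' s : ℕ, Real.exp ((s * (s + 1) / 2 : ℝ) * Real.log q),
    mul_nonneg hB0 (tsum_nonneg fun _ => (Real.exp_pos _).le), fun m n => ?_⟩
  -- This exponent is the mean of i(i+1)/2 + in at i = m and i = m + 1, the last retained and first
  -- omitted terms.
  set E := Real.exp (((m + 1 / 2) * n + (m + 1) ^ 2 / 2 : ℝ) * Real.log q) with hE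
  have key : ∀ (i s : ℕ), (m + 1 / 2) * n + (m + 1) ^ 2 / 2 + (s * (s + 1) / 2 : ℝ) ≤
      i * (i + 1) / 2 + i * n → |eulerCoeff q i * Real.exp (i * n * Real.log q)| ≤
      B * E * Real.exp ((s * (s + 1) / 2 : ℝ) * Real.log q) := fun i s his => by
    rw [abs_mul, abs_of_pos (Real.exp_pos _)]
    refine (mul_le_mul_of_nonneg_right (abs_eulerCoeff_le hq0 hq1 i) (Real.exp_pos _).le).trans ?_
    rw [mul_assoc, mul_assoc B, hE, ← Real.exp_add, ← Real.exp_add]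
    refine mul_le_mul_of_nonneg_left (Real.exp_le_exp.2 ?_) hB0
    rw [← add_mul, ← add_mul]
    exact mul_le_mul_of_nonpos_right his hl.le
  rw [mul_right_comm]
  have hsE := hsum.hasSum.mul_left (B * E)
  -- If n ≥ -m-1, the exponents increase from i = m on and the tail is bounded. Otherwise 1/(q;q)_n
  -- = 0, and the retained terms themselves are bounded, read backwards from i = m.
  rcases le_or_gt 0 (n + m + 1) with hn | hn
  · have hn' : (0 : ℝ) ≤ n + m + 1 := by exact_mod_cast hn
    rw [← (hasSum_eulerCoeff hq0 hq1 n).tsum_eq,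
      ← (hasSum_eulerCoeff hq0 hq1 n).summable.sum_add_tsum_nat_add (m + 1), add_sub_cancel_left,
      ← Real.norm_eq_abs]
    refine tsum_of_norm_bounded hsE fun s => key _ s ?_
    have hs : (0 : ℝ) ≤ s := Nat.cast_nonneg s
    push_cast
    nlinarith [mul_nonneg hs hn']
  · have hn' : (n : ℝ) + m + 1 ≤ -1 := by
      have : n + m + 1 ≤ -1 := by omega
      exact_mod_cast this
    rw [qRecip_of_neg q (by omega), zero_sub, abs_neg,
      ← Finset.sum_flip fun i : ℕ => eulerCoeff q i * Real.exp (i * n * Real.log q)]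
    refine (Finset.abs_sum_le_sum_abs _ _).trans ((Finset.sum_le_sum fun s hs => ?_).trans
      (hsE.summable.sum_le_tsum (range (m + 1)) fun s _ => by positivity) |>.trans_eq hsE.tsum_eq)
    have hsm : s ≤ m := by rw [Finset.mem_range] at hs; omega
    refine key _ s ?_
    have hs : (0 : ℝ) ≤ s := Nat.cast_nonneg s
    push_cast [Nat.cast_sub hsm]
    nlinarith [mul_nonneg hs (by linarith : (0 : ℝ) ≤ -1 - (n + m + 1))]

/-- If all the nonnegative moments of `c` vanish, its transform decays rapidly at `-∞`. -/
theorem exists_abs_qTransform_le {q t : ℝ} (hq0 : 0 < q) (hq1 : q < 1) {c : ℤ → ℝ} {A : ℝ}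
    (hc : ∀ k, |c k| ≤ A * swRoot q t k)
    (hm : ∀ m : ℕ, HasSum (fun k : ℤ => c k * Real.exp (m * k * Real.log q)) 0) :
    ∃ K, ∀ L : ℕ, |qTransform q c 0 (-L)| ≤
      K * Real.exp (-L * Real.log t + (L ^ 2 / 2 : ℝ) * Real.log q) := by
  have hl : Real.log q < 0 := Real.log_neg hq0 hq1
  obtain ⟨K, hK0, hK⟩ := exists_abs_qRecip_sub_le hq0 hq1
  have hcs := summable_of_abs_le_swRoot hq0 hq1 hc
  set g : ℤ → ℝ := fun j => Real.exp (j / 2 * Real.log t +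
    (j ^ 2 / 4 + 3 * j / 4 + 1 / 2 : ℝ) * Real.log q) with hg
  have hgs : Summable g :=
    ((summable_exp_quadratic_int (a := Real.log q / 4) (by linarith)
      (Real.log t / 2 + 3 * Real.log q / 4)).mul_right (Real.exp (Real.log q / 2))).congr
      fun s => by rw [← Real.exp_add]; congr 1; ring
  refine ⟨A * K * ∑' j, g j, fun L => ?_⟩
  have h1 : HasSum (fun k : ℤ => c k * qRecip q (k + L)) (qTransform q c 0 (-L)) := by
    rw [← (Equiv.addRight (-(L : ℤ))).hasSum_iff]
    have h := (hasSum_mul_qRecip_iff (q := q) (f := fun N : ℤ => c (-L + N))).2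
      (summable_div_qPoch_self hq0 hq1 (summable_comp_int_add_nat hcs (-L))).hasSum
    refine (h.congr_fun fun N => ?_).congr_right ?_
    · simp only [Function.comp_apply, Equiv.coe_addRight, neg_add_cancel_right]
      rw [add_comm]
    · simp [qTransform]
  -- By the vanishing moments, the Euler expansion truncated at order L contributes nothing, so
  -- 1/(q;q)_{k+L} may be replaced by its remainder.
  have h2 : HasSum (fun k : ℤ => c k * ∑ i ∈ range (L + 1),
      eulerCoeff q i * Real.exp (i * (k + L : ℤ) * Real.log q)) 0 := by
    have h : HasSum (fun k : ℤ => ∑ i ∈ range (L + 1), eulerCoeff q i *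
        Real.exp (i * L * Real.log q) * (c k * Real.exp (i * k * Real.log q)))
        (∑ i ∈ range (L + 1), eulerCoeff q i * Real.exp (i * L * Real.log q) * 0) :=
      hasSum_sum fun i _ => (hm i).mul_left _
    simp only [mul_zero, Finset.sum_const_zero] at h
    refine h.congr_fun fun k => ?_
    rw [Finset.mul_sum]
    refine Finset.sum_congr rfl fun i _ => ?_
    have : Real.exp (i * (k + L : ℤ) * Real.log q) =
        Real.exp (i * L * Real.log q) * Real.exp (i * k * Real.log q) := by
      rw [← Real.exp_add]; congr 1; push_cast; ring
    rw [this]; ring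
  have h3 := h1.sub h2
  rw [sub_zero] at h3
  have h4 := ((Equiv.addRight (2 * L : ℤ)).hasSum_iff.2 hgs.hasSum).mul_left
    (A * K * Real.exp (-L * Real.log t + (L ^ 2 / 2 : ℝ) * Real.log q))
  rw [← h3.tsum_eq, mul_right_comm, ← Real.norm_eq_abs]
  refine tsum_of_norm_bounded h4 fun k => ?_
  rw [← mul_sub, norm_mul]
  refine (mul_le_mul (hc k) (hK L (k + L)) (abs_nonneg _) ((abs_nonneg _).trans (hc k))).trans_eq ?_
  -- Putting k = j - 2L removes the mixed term and separates the L-dependence from a fixed Gaussian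
  -- g(j).
  have : swRoot q t k * Real.exp (((L + 1 / 2) * (k + L : ℤ) + (L + 1) ^ 2 / 2 : ℝ) * Real.log q) =
      Real.exp (-L * Real.log t + (L ^ 2 / 2 : ℝ) * Real.log q) * g (k + 2 * L) := by
    simp only [hg, swRoot]
    rw [← Real.exp_add, ← Real.exp_add]
    congr 1
    push_cast
    ring
  simp only [Function.comp_apply, Equiv.coe_addRight]
  linear_combination (A * K) * this

theorem summable_comp_int_add_of_summable_nat {b : ℤ → ℝ} (hb : Summable fun n : ℕ => b n)
    (r : ℤ) : Summable fun n : ℕ => b (r + n) := by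
  rw [← summable_nat_add_iff r.natAbs]
  have h := hb.comp_injective (i := fun n : ℕ => (r + (n + r.natAbs : ℕ)).toNat) fun x y h => by
    simp only at h
    omega
  refine h.congr fun n => ?_
  simp only [Function.comp_apply]
  congr 1
  omega

/-- A sequence annihilating all monomials and all `q`-Bessel functions vanishes. -/
theorem eq_zero_of_orthogonal {q t : ℝ} (hq0 : 0 < q) (hq1 : q < 1) (ht : 0 < t) {c : ℤ → ℝ}
    {A : ℝ} (hc : ∀ k, |c k| ≤ A * swRoot q t k)
    (hm : ∀ m : ℕ, HasSum (fun k : ℤ => c k * (t * q ^ k) ^ m) 0)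
    (hM : ∀ r : ℤ, HasSum (fun k : ℤ => c k * besselM q t r (t * q ^ k)) 0) (k : ℤ) : c k = 0 := by
  have hl : Real.log q < 0 := Real.log_neg hq0 hq1
  have hm' : ∀ m : ℕ, HasSum (fun k : ℤ => c k * Real.exp (m * k * Real.log q)) 0 := fun m => by
    refine (((hm m).mul_left (t ^ m)⁻¹).congr_fun fun k => ?_).congr_right (mul_zero _).symm
    rw [mul_pow, zpow_eq_exp_mul_log hq0, ← Real.exp_nat_mul, mul_assoc]
    have := (pow_pos ht m).ne'
    field_simp
  obtain ⟨K, hK⟩ := exists_abs_qTransform_le hq0 hq1 hc hm'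
  set b : ℤ → ℝ := fun L => qTransform q c 0 (-L) * ((-1) ^ L *
    Real.exp (L * Real.log t - (L * (L - 1) / 2 : ℝ) * Real.log q)) with hb
  have hbs : Summable fun n : ℕ => b n := by
    -- The decay q^{L²/2} beats the normalisation q^{-L(L-1)/2} by exactly q^{L/2}.
    have hgeo : Summable fun n : ℕ => K * Real.exp (n * (Real.log q / 2)) :=
      (Real.summable_exp_nat_mul_iff.2 (by linarith)).mul_left K
    refine Summable.of_norm_bounded hgeo fun n => ?_
    simp only [hb]
    rw [norm_mul, norm_mul, norm_zpow, norm_neg, norm_one, one_zpow, one_mul,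
      Real.norm_of_nonneg (Real.exp_pos _).le]
    refine (mul_le_mul_of_nonneg_right (hK n) (Real.exp_pos _).le).trans_eq ?_
    rw [mul_assoc, ← Real.exp_add]
    congr 2
    push_cast
    ring
  have hbr := summable_comp_int_add_of_summable_nat hbs
  have hterm : ∀ (r : ℤ) (p : ℕ), qTransform q c 0 (-r - p) *
      (-Real.exp (Real.log t - r * Real.log q)) ^ p / qPoch q q p =
      (-1) ^ r * Real.exp (-r * Real.log t + (r * (r - 1) / 2 : ℝ) * Real.log q) *
      (b (r + p) * q ^ p.choose 2 / qPoch q q p) := fun r p => by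
    simp only [hb]
    rw [neg_pow, ← Real.exp_nat_mul, pow_choose_two_eq_exp hq0, neg_add', zpow_add₀ (by norm_num),
      zpow_natCast]
    have hs : (-1 : ℝ) ^ r * (-1) ^ r = 1 := by rw [← mul_zpow]; simp
    have : ∀ a c d e σ τ P Q : ℝ, σ * σ = 1 → a = c * d * e →
        Q * (τ * a) / P = σ * c * (Q * (σ * τ * d) * e / P) := fun a c d e σ τ P Q hσ h => by
      rw [h]; linear_combination (-Q * τ * c * d * e / P) * hσ
    refine this _ _ _ _ _ _ _ _ hs ?_
    rw [← Real.exp_add, ← Real.exp_add]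
    congr 1
    push_cast
    ring
  have hb' : ∀ r : ℤ, Summable fun n : ℕ => b (r + n) * q ^ n.choose 2 / qPoch q q n := fun r => by
    refine summable_div_qPoch_self hq0 hq1 (Summable.of_norm_bounded (hbr r).norm fun n => ?_)
    rw [norm_mul, Real.norm_of_nonneg (by positivity : (0 : ℝ) ≤ q ^ n.choose 2)]
    exact mul_le_of_le_one_right (norm_nonneg _) (pow_le_one₀ hq0.le hq1.le)
  have hb0 : ∀ L, b L = 0 := eq_zero_of_tsum_euler_eq_zero hq0 hq1 hbr fun r => by
    have h1 := hasSum_mul_besselM hq0 hq1 ht hc r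
      (((hb' r).mul_left _).congr fun p => (hterm r p).symm)
    have h2 := (hM r).unique h1
    rw [tsum_congr (hterm r), tsum_mul_left] at h2
    have h3 := qPochInf_pos hq0 hq1 (a := -Real.exp (Real.log t - r * Real.log q))
      (by linarith [Real.exp_pos (Real.log t - r * Real.log q)])
    have h4 := Real.exp_pos (-r * Real.log t + (r * (r - 1) / 2 : ℝ) * Real.log q)
    have h5 : (-1 : ℝ) ^ r ≠ 0 := zpow_ne_zero _ (by norm_num)
    have h6 := (mul_eq_zero.1 h2.symm).resolve_left h3.ne'
    exact (mul_eq_zero.1 h6).resolve_left (mul_ne_zero h5 h4.ne')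
  refine eq_zero_of_qTransform_eq_zero hq0 hq1 (summable_of_abs_le_swRoot hq0 hq1 hc)
    (fun l => ?_) k
  have h1 := hb0 (-l)
  simp only [hb, neg_neg] at h1
  exact (mul_eq_zero.1 h1).resolve_right
    (mul_ne_zero (zpow_ne_zero _ (by norm_num)) (Real.exp_pos _).ne')

/-! ### The Hilbert space `L²(μ_t)` -/

theorem aestronglyMeasurable_swMeasure (q t : ℝ) (f : ℝ → ℂ) :
    AEStronglyMeasurable f (swMeasure q t) :=
  aestronglyMeasurable_sum_measure_iff.2 fun _ => aestronglyMeasurable_dirac.smul_measure _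

theorem memLp_swMeasure {q t : ℝ} (hq0 : 0 < q) (ht : 0 < t) {g : ℝ → ℝ}
    (hg : Summable fun k : ℤ => swWeight q t k * g (t * q ^ k) * g (t * q ^ k)) :
    MemLp (fun x => (g x : ℂ)) 2 (swMeasure q t) := by
  rw [memLp_two_iff_integrable_sq_norm (aestronglyMeasurable_swMeasure q t _)]
  refine integrable_sum_dirac (fun _ => ENNReal.ofReal_ne_top) (hg.congr fun k => ?_)
  rw [ENNReal.toReal_ofReal (swWeight_pos hq0 ht k).le, Real.norm_of_nonneg (sq_nonneg _),
    Complex.norm_real, Real.norm_eq_abs, sq_abs, sq, mul_assoc]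

/-- Every atom has positive mass, so an L² class has well-defined values on the lattice. -/
theorem eq_of_ae_swMeasure {q t : ℝ} (hq0 : 0 < q) (ht : 0 < t) {p : ℝ → Prop}
    (h : ∀ᵐ x ∂swMeasure q t, p x) (k : ℤ) : p (t * q ^ k) := by
  rw [swMeasure, Measure.ae_sum_iff] at h
  have h1 := h k
  rw [Measure.ae_ennreal_smul_measure_iff
    (ENNReal.ofReal_pos.2 (swWeight_pos hq0 ht k)).ne', ae_dirac_eq] at h1
  exact h1

theorem ae_swMeasure {q t : ℝ} {p : ℝ → Prop} (h : ∀ k : ℤ, p (t * q ^ k)) :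
    ∀ᵐ x ∂swMeasure q t, p x := by
  rw [swMeasure, Measure.ae_sum_iff]
  intro k
  refine Measure.ae_smul_measure ?_ _
  rw [ae_dirac_eq]
  exact h k

theorem hasSum_inner_toLp {q t : ℝ} (hq0 : 0 < q) (ht : 0 < t) {g : ℝ → ℝ}
    (hg : MemLp (fun x => (g x : ℂ)) 2 (swMeasure q t)) (f : Lp ℂ 2 (swMeasure q t)) :
    HasSum (fun k : ℤ => ((swWeight q t k * g (t * q ^ k) : ℝ) : ℂ) * f (t * q ^ k))
      (inner ℂ (hg.toLp _) f) := by
  have hae : ∀ k : ℤ, (hg.toLp _ : ℝ → ℂ) (t * q ^ k) = (g (t * q ^ k) : ℂ) :=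
    eq_of_ae_swMeasure (p := fun x => (hg.toLp _ : ℝ → ℂ) x = (g x : ℂ)) hq0 ht hg.coeFn_toLp
  generalize hg.toLp (fun x => (g x : ℂ)) = F at hae ⊢
  let φ : ℝ → ℂ := fun x => inner ℂ (F x) (f x)
  let w : ℤ → ℝ≥0∞ := fun k => ENNReal.ofReal (swWeight q t k)
  have h1 : Integrable φ (Measure.sum fun k : ℤ => w k • Measure.dirac (t * q ^ k)) :=
    L2.integrable_inner F f
  have h2 : HasSum (fun k : ℤ => (w k).toReal • φ (t * q ^ k)) (∫ x, φ x ∂swMeasure q t) :=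
    hasSum_integral_sum_dirac (f := φ) (c := w) (x := fun k : ℤ => t * q ^ k)
      (fun _ => ENNReal.ofReal_ne_top)
      (Integrable.summable_of_dirac (f := φ) (c := w) (x := fun k : ℤ => t * q ^ k) h1)
  rw [L2.inner_def]
  refine h2.congr_fun fun k => ?_
  simp only [φ, w]
  rw [hae k, ENNReal.toReal_ofReal (swWeight_pos hq0 ht k).le, RCLike.inner_apply,
    Complex.conj_ofReal, Complex.real_smul, Complex.ofReal_mul]
  ring

theorem inner_toLp_toLp {q t : ℝ} (hq0 : 0 < q) (ht : 0 < t) {g h : ℝ → ℝ} {a : ℝ}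
    (hg : MemLp (fun x => (g x : ℂ)) 2 (swMeasure q t))
    (hh : MemLp (fun x => (h x : ℂ)) 2 (swMeasure q t))
    (ha : HasSum (fun k : ℤ => swWeight q t k * g (t * q ^ k) * h (t * q ^ k)) a) :
    inner ℂ (hg.toLp _) (hh.toLp _) = (a : ℂ) := by
  refine (hasSum_inner_toLp hq0 ht hg (hh.toLp _)).unique
    ((Complex.hasSum_ofReal.2 ha).congr_fun fun k => ?_)
  rw [eq_of_ae_swMeasure hq0 ht hh.coeFn_toLp k, ← Complex.ofReal_mul]

theorem exists_norm_swRoot_mul_le {q t : ℝ} (hq0 : 0 < q) (ht : 0 < t)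
    (f : Lp ℂ 2 (swMeasure q t)) : ∃ A, ∀ k : ℤ, swRoot q t k * ‖f (t * q ^ k)‖ ≤ A := by
  have h := (memLp_two_iff_integrable_sq_norm (Lp.aestronglyMeasurable f)).1 (Lp.memLp f)
  obtain ⟨A, -, hA⟩ := exists_abs_le_of_summable (Integrable.summable_of_dirac h)
  refine ⟨A + 1, fun k => ?_⟩
  have h1 := (le_abs_self _).trans (hA k)
  rw [ENNReal.toReal_ofReal (swWeight_pos hq0 ht k).le, Real.norm_of_nonneg (sq_nonneg _),
    ← swRoot_mul_self hq0 ht] at h1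
  nlinarith [sq_nonneg (swRoot q t k * ‖f (t * q ^ k)‖ - 1)]

/-- Triangularity: S_m has degree exactly m, so monomials are recovered by induction. -/
theorem hasSum_mul_pow_of_stieltjesWigert {q t : ℝ} (hq0 : 0 < q) (hq1 : q < 1) {c : ℤ → ℝ}
    (h : ∀ n : ℕ, HasSum (fun k : ℤ => c k * stieltjesWigert q n (t * q ^ k)) 0) (m : ℕ) :
    HasSum (fun k : ℤ => c k * (t * q ^ k) ^ m) 0 := by
  induction m using Nat.strong_induction_on with
  | _ m ih =>
    set a : ℕ → ℝ := fun i => (-1) ^ i * q ^ (i ^ 2) / (qPoch q q i * qPoch q q (m - i)) with ha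
    have ham : a m ≠ 0 := div_ne_zero (mul_ne_zero (pow_ne_zero _ (by norm_num))
      (pow_ne_zero _ hq0.ne')) (mul_ne_zero (qPoch_self_pos hq0 hq1 _).ne'
        (qPoch_self_pos hq0 hq1 _).ne')
    have h1 : HasSum (fun k : ℤ => ∑ i ∈ range m, a i * (c k * (t * q ^ k) ^ i))
        (∑ i ∈ range m, a i * 0) :=
      hasSum_sum fun i hi => (ih i (Finset.mem_range.1 hi)).mul_left (a i)
    simp only [mul_zero, Finset.sum_const_zero] at h1
    have h2 := ((h m).sub h1).mul_left (a m)⁻¹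
    rw [sub_zero, mul_zero] at h2
    refine h2.congr_fun fun k => ?_
    rw [stieltjesWigert_eq hq0 hq1, Finset.Nat.sum_antidiagonal_eq_sum_range_succ
      (fun i j => (-1) ^ i * q ^ (i ^ 2) / (qPoch q q i * qPoch q q j) * (t * q ^ k) ^ i),
      Finset.sum_range_succ, mul_add, Finset.mul_sum]
    have h3 : ∑ i ∈ range m, c k * ((-1) ^ i * q ^ (i ^ 2) / (qPoch q q i * qPoch q q (m - i)) *
        (t * q ^ k) ^ i) = ∑ i ∈ range m, a i * (c k * (t * q ^ k) ^ i) :=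
      Finset.sum_congr rfl fun i _ => by simp only [ha]; ring
    have h4 : c k * ((-1) ^ m * q ^ (m ^ 2) / (qPoch q q m * qPoch q q (m - m)) *
        (t * q ^ k) ^ m) = a m * (c k * (t * q ^ k) ^ m) := by simp only [ha]; ring
    rw [h3, h4, add_sub_cancel_left, inv_mul_cancel_left₀ ham]

/-- An element of `L²(μ_t)` orthogonal to all the functions `S_n` and `M_r` is zero. -/
theorem eq_zero_of_inner_eq_zero {q t : ℝ} (hq0 : 0 < q) (hq1 : q < 1) (ht : 0 < t)
    (hS : ∀ n : ℕ, MemLp (fun x : ℝ => (stieltjesWigert q n x : ℂ)) 2 (swMeasure q t))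
    (hM : ∀ r : ℤ, MemLp (fun x : ℝ => (besselM q t r x : ℂ)) 2 (swMeasure q t))
    (f : Lp ℂ 2 (swMeasure q t)) (hfS : ∀ n, inner ℂ ((hS n).toLp _) f = 0)
    (hfM : ∀ r, inner ℂ ((hM r).toLp _) f = 0) : f = 0 := by
  obtain ⟨A, hA⟩ := exists_norm_swRoot_mul_le hq0 ht f
  -- The S_n and M_r are real, so the real and imaginary parts of f are treated separately by the
  -- real-valued uniqueness result.
  have key : ∀ φ : ℂ →L[ℝ] ℝ, (∀ z, |φ z| ≤ ‖z‖) → ∀ k : ℤ, φ (f (t * q ^ k)) = 0 := by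
    intro φ hφ k
    have hsum : ∀ {g : ℝ → ℝ} (hg : MemLp (fun x => (g x : ℂ)) 2 (swMeasure q t)),
        inner ℂ (hg.toLp _) f = 0 →
        HasSum (fun k : ℤ => swWeight q t k * φ (f (t * q ^ k)) * g (t * q ^ k)) 0 :=
      fun {g} hg h => by
        have h1 := hasSum_inner_toLp hq0 ht hg f
        rw [h] at h1
        refine ((φ.hasSum h1).congr_fun fun k => ?_).congr_right (map_zero φ).symm
        rw [← Complex.real_smul, map_smul, smul_eq_mul]
        ring
    have h0 := eq_zero_of_orthogonal hq0 hq1 ht (c := fun k => swWeight q t k * φ (f (t * q ^ k)))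
      (A := A) (fun k => by
        rw [← swRoot_mul_self hq0 ht, mul_assoc, abs_mul, abs_of_pos (swRoot_pos q t k), mul_comm]
        refine mul_le_mul_of_nonneg_right ?_ (swRoot_pos q t k).le
        rw [abs_mul, abs_of_pos (swRoot_pos q t k)]
        exact (mul_le_mul_of_nonneg_left (hφ _) (swRoot_pos q t k).le).trans (hA k))
      (hasSum_mul_pow_of_stieltjesWigert hq0 hq1 fun n => hsum (hS n) (hfS n))
      (fun r => hsum (hM r) (hfM r)) k
    exact (mul_eq_zero.1 h0).resolve_left (swWeight_pos hq0 ht k).ne'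
  rw [Lp.eq_zero_iff_ae_eq_zero]
  exact ae_swMeasure fun k => Complex.ext
    (key Complex.reCLM (fun z => Complex.abs_re_le_norm z) k)
    (key Complex.imCLM (fun z => Complex.abs_im_le_norm z) k)

theorem qPochInt_pos {a q : ℝ} (hq0 : 0 < q) (ha : a ≤ 0) (r : ℤ) : 0 < qPochInt a q r := by
  have hpos : ∀ i : ℤ, 0 < 1 - a * q ^ i := fun i => by
    have : 0 < q ^ i := zpow_pos hq0 _
    nlinarith
  rcases r with n | n
  · change 0 < qPoch a q n
    exact Finset.prod_pos (f := fun i => 1 - a * q ^ i) fun i _ => by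
      rw [← zpow_natCast]; exact hpos i
  · exact one_div_pos.2 (Finset.prod_pos fun i _ => hpos _)

theorem hasSum_stieltjesWigert_mul_besselM {q t : ℝ} (hq0 : 0 < q) (hq1 : q < 1) (ht : 0 < t)
    (n : ℕ) (r : ℤ) : HasSum (fun k : ℤ => swWeight q t k *
      stieltjesWigert q n (t * q ^ k) * besselM q t r (t * q ^ k)) 0 := by
  have h : HasSum (fun k : ℤ => ∑ p ∈ antidiagonal n,
      (-1) ^ p.1 * q ^ (p.1 ^ 2) / (qPoch q q p.1 * qPoch q q p.2) *
      (swWeight q t k * (t * q ^ k) ^ p.1 * besselM q t r (t * q ^ k)))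
      (∑ p ∈ antidiagonal n, (-1) ^ p.1 * q ^ (p.1 ^ 2) / (qPoch q q p.1 * qPoch q q p.2) * 0) :=
    hasSum_sum fun p _ => (hasSum_pow_mul_besselM hq0 hq1 ht p.1 r).mul_left _
  simp only [mul_zero, Finset.sum_const_zero] at h
  refine h.congr_fun fun k => ?_
  rw [stieltjesWigert_eq hq0 hq1, Finset.mul_sum, Finset.sum_mul]
  exact Finset.sum_congr rfl fun p _ => by ring

theorem theorem3p5 (q t : ℝ) (hq0 : 0 < q) (hq1 : q < 1) (ht : 0 < t) :
    -- orthogonality relations, the bilateral series being absolutely convergent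
    (∀ n m : ℕ,
      Summable (fun k : ℤ => swWeight q t k *
        stieltjesWigert q n (t * q ^ k) * stieltjesWigert q m (t * q ^ k)) ∧
      1 / (qPochInf (-(t * q)) q * qPochInf (-(1 / t)) q * qPochInf q q) *
        (∑' k : ℤ, swWeight q t k *
          stieltjesWigert q n (t * q ^ k) * stieltjesWigert q m (t * q ^ k)) =
        (if m = n then 1 else 0) / (q ^ n * qPoch q q n)) ∧
    (∀ r s : ℤ,
      Summable (fun k : ℤ => swWeight q t k *
        besselM q t r (t * q ^ k) * besselM q t s (t * q ^ k)) ∧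
      1 / qPochInf (-t) q *
        (∑' k : ℤ, swWeight q t k *
          besselM q t r (t * q ^ k) * besselM q t s (t * q ^ k)) =
        qPochInt (-(q / t)) q r / q ^ r * (if r = s then 1 else 0)) ∧
    (∀ (n : ℕ) (r : ℤ),
      HasSum (fun k : ℤ => swWeight q t k *
        stieltjesWigert q n (t * q ^ k) * besselM q t r (t * q ^ k)) 0) ∧
    -- the functions lie in `L²(μ_t)` and together form an orthogonal basis of it
    ∃ (hS : ∀ n : ℕ, MemLp (fun x : ℝ => (stieltjesWigert q n x : ℂ)) 2 (swMeasure q t))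
      (hM : ∀ r : ℤ, MemLp (fun x : ℝ => (besselM q t r x : ℂ)) 2 (swMeasure q t)),
      IsOrthogonalBasis (H := Lp ℂ 2 (swMeasure q t))
        (Sum.elim (fun n : ℕ => (hS n).toLp _) (fun r : ℤ => (hM r).toLp _)) := by
  have hΘ := tsum_swWeight_pos hq0 hq1 ht
  have htp : 0 < qPochInf (-t) q := qPochInf_pos hq0 hq1 (by linarith)
  have hqt : -(q / t) ≤ 0 := neg_nonpos.2 (by positivity)
  have hSS := hasSum_stieltjesWigert_mul hq0 hq1 ht
  have hMM := hasSum_besselM_mul hq0 hq1 ht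
  have hSM := hasSum_stieltjesWigert_mul_besselM hq0 hq1 ht
  have hS : ∀ n : ℕ, MemLp (fun x : ℝ => (stieltjesWigert q n x : ℂ)) 2 (swMeasure q t) :=
    fun n => memLp_swMeasure hq0 ht (hSS n n).summable
  have hM : ∀ r : ℤ, MemLp (fun x : ℝ => (besselM q t r x : ℂ)) 2 (swMeasure q t) :=
    fun r => memLp_swMeasure hq0 ht (hMM r r).summable
  refine ⟨fun n m => ⟨(hSS n m).summable, ?_⟩, fun r s => ⟨(hMM r s).summable, ?_⟩, hSM, hS, hM,
    ?_, ?_, ?_⟩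
  · rw [(hSS n m).tsum_eq, one_div, inv_mul_cancel_left₀ hΘ.ne']
  · rw [(hMM r s).tsum_eq, one_div, inv_mul_cancel_left₀ htp.ne']
  · rintro (n | r) h0
    · have h1 := inner_toLp_toLp hq0 ht (hS n) (hS n) (hSS n n)
      have h2 : (hS n).toLp _ = 0 := h0
      rw [h2, inner_zero_left, if_pos rfl, eq_comm, Complex.ofReal_eq_zero] at h1
      have := qPoch_self_pos hq0 hq1 n
      exact absurd h1 (by positivity)
    · have h1 := inner_toLp_toLp hq0 ht (hM r) (hM r) (hMM r r)
      have h2 : (hM r).toLp _ = 0 := h0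
      rw [h2, inner_zero_left, if_pos rfl, eq_comm, Complex.ofReal_eq_zero] at h1
      have := qPochInt_pos hq0 hqt r
      exact absurd h1 (by positivity)
  · rintro (n | r) (m | s) hne
    · have h1 := inner_toLp_toLp hq0 ht (hS n) (hS m) (hSS n m)
      rw [if_neg fun h => hne (by rw [h]), zero_div, mul_zero, Complex.ofReal_zero] at h1
      exact h1
    · exact (inner_toLp_toLp hq0 ht (hS n) (hM s) (hSM n s)).trans Complex.ofReal_zero
    · exact (inner_toLp_toLp hq0 ht (hM r) (hS m) ((hSM m r).congr_fun fun k => by ring)).trans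
        Complex.ofReal_zero
    · have h1 := inner_toLp_toLp hq0 ht (hM r) (hM s) (hMM r s)
      rw [if_neg fun h => hne (by rw [h]), mul_zero, mul_zero, Complex.ofReal_zero] at h1
      exact h1
  · rw [Submodule.topologicalClosure_eq_top_iff, Submodule.eq_bot_iff]
    intro f hf
    rw [Submodule.mem_orthogonal] at hf
    exact eq_zero_of_inner_eq_zero hq0 hq1 ht hS hM f
      (fun n => hf _ (Submodule.subset_span ⟨Sum.inl n, rfl⟩))
      (fun r => hf _ (Submodule.subset_span ⟨Sum.inr r, rfl⟩))
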